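/- **Setting.** Write $\omega(\xi,\xi')=xy'-x'y$ for $\xi=(x,y),\ \xi'=(x',y')\in\mathbb R^2$, let $A=\begin{pmatrix}0&1\\1&0\end{pmatrix}$, and identify $\mathbb R^2\cong\mathbb C$ (with conjugation $\xi\mapsto\bar\xi$). The Heisenberg group is $H=\mathbb R\times\mathbb R^2$ with $(z,\xi)(z',\xi')=(z+z'+\frac12\omega(\xi,\xi'),\xi+\xi')$, and the split oscillator group is $\mathrm{Osc}=H\rtimes\mathbb R$, where $t.(z,\xi)=(z,e^{tA}\xi)$. Let $X=\mathrm{Osc}$ be endowed with the bi-invariant pseudo-Riemannian metric of signature $(2,2)$ given at the identity by $\langle(Z,(X_1,X_2),T),(Z',(X_1',X_2'),T')\rangle=-X_1X_1'+X_2X_2'+ZT'+Z'T$. The unity component of the isometry group of $X$ is $G=H_2\rtimes(\mathbb R\oplus\mathbb R)$, with elements $(z,\xi_1,\xi_2,t,s)$. Here $H_2=\mathbb R\times\mathbb C\times\mathbb C$ has the multiplication $(z,\xi_1,\xi_2)(z',\xi_1',\xi_2')=(z+z'+\frac12(\omega(\xi_1,\xi_1')-\omega(\xi_2,\xi_2')),\xi_1+\xi_1',\xi_2+\xi_2')$;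 $t$ acts on it by $(z,e^{tA}\xi_1,e^{tA}\xi_2)$ and $s$ acts by $(z,e^{s\phi}(\xi_1,\xi_2))$, with $\phi(\xi_1,\xi_2)=(\xi_2,\xi_1)$. The element $(z,\xi_1,\xi_2,t,s)$ acts on $X$ by $x\mapsto(2z,\xi_1+A\xi_2,t+s)\cdot x\cdot(0,0,t-s)\cdot(0,\overline{\xi_1-A\xi_2},0)$; the left translations of $X$ form the image of $\iota:\mathrm{Osc}\hookrightarrow G$, $(2z,2\xi,2t)\mapsto(z,\xi,A\xi,t,t)$. Let $p:G\to\mathbb R$, $(z,\xi_1,\xi_2,t,s)\mapsto t$, and let $N=\{(z,\xi,-A\xi,t,t)\mid z,t\in\mathbb R,\ \xi\in\mathbb C\}\subset G$. This is a subgroup isomorphic to $H\times\mathbb R$ via $((z,\xi),t)\mapsto(2z,\xi,-A\xi,t,t)$, and $p|_N$ corresponds to the projection to the $\mathbb R$-factor. A lattice in a Lie group $K$ is a discrete subgroup $L$ such that $L\backslash K$ has a finite (non-zero) invariant measure. A compact quotient of $X$ is $\Gamma\backslash X$ for a discrete subgroup $\Gamma\subset G$ that acts (by isometries) freely and properly on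 $X$ such that $\Gamma\backslash X$ is compact. It is called straight if $p(\Gamma)\subset\mathbb R$ is discrete, and non-straight otherwise. **Proposition 10.3.** 1. For every lattice $L$ of $\mathrm{Osc}$, acting on $X=\mathrm{Osc}$ by left translations (i.e. through $\iota$), the quotient $L\backslash X=\iota(L)\backslash X$ is a compact quotient of $X$, and it is straight. 2. $X$ also admits non-straight compact quotients by discrete groups of isometries. More precisely, there is a lattice $\Lambda$ in $H\times\mathbb R$ whose projection to the $\mathbb R$-factor is dense in $\mathbb R$ such that the corresponding subgroup $\Gamma\subset N\subset G$ gives a compact quotient $\Gamma\backslash X$ that is not straight. -/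

import Mathlib

open scoped Matrix ContDiff

noncomputable section

/-! ## Plane linear algebra: `ω`, `A`, `e^{tA}`, conjugation -/

/-- The symplectic form `ω(ξ, ξ') = x y' - x' y` on the plane. -/
def omegaForm (ξ η : ℝ × ℝ) : ℝ := ξ.1 * η.2 - η.1 * ξ.2

/-- The matrix `A`, with rows `(0, 1)` and `(1, 0)`, acting on the plane. -/
def swapA (ξ : ℝ × ℝ) : ℝ × ℝ := (ξ.2, ξ.1)

/-- The hyperbolic rotation `e^{tA}`. -/
def hypRot (t : ℝ) (ξ : ℝ × ℝ) : ℝ × ℝ :=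
  (Real.cosh t * ξ.1 + Real.sinh t * ξ.2, Real.sinh t * ξ.1 + Real.cosh t * ξ.2)

/-- Complex conjugation on the plane, identified with the complex numbers. -/
def planeConj (ξ : ℝ × ℝ) : ℝ × ℝ := (ξ.1, -ξ.2)

/-- `hypRot t` is the action of the matrix exponential of `tA`. -/
theorem exp_smul_A (t : ℝ) :
    NormedSpace.exp (t • (!![0, 1; 1, 0] : Matrix (Fin 2) (Fin 2) ℝ)) =
      !![Real.cosh t, Real.sinh t; Real.sinh t, Real.cosh t] := by
  have hU : IsUnit (!![1, 1; 1, -1] : Matrix (Fin 2) (Fin 2) ℝ) := by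
    rw [Matrix.isUnit_iff_isUnit_det]
    norm_num [Matrix.det_fin_two_of]
  have hinv : (!![1, 1; 1, -1] : Matrix (Fin 2) (Fin 2) ℝ)⁻¹ = !![1/2, 1/2; 1/2, -1/2] := by
    apply Matrix.inv_eq_right_inv
    ext i j
    fin_cases i <;> fin_cases j <;> norm_num [Matrix.mul_apply, Fin.sum_univ_two]
  have hdiag : ∀ a b : ℝ, Matrix.diagonal ![a, b] = !![a, 0; 0, b] := by
    intro a b
    ext i j
    fin_cases i <;> fin_cases j <;> simp
  have h1 : t • (!![0, 1; 1, 0] : Matrix (Fin 2) (Fin 2) ℝ) =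
      !![1, 1; 1, -1] * Matrix.diagonal ![t, -t] * (!![1, 1; 1, -1])⁻¹ := by
    rw [hinv, hdiag, Matrix.mul_fin_two, Matrix.mul_fin_two]
    ext i j
    fin_cases i <;> fin_cases j <;> simp <;> ring
  have h2 : NormedSpace.exp (![t, -t] : Fin 2 → ℝ) = ![Real.exp t, Real.exp (-t)] := by
    ext i
    rw [Pi.coe_exp]
    fin_cases i <;> simp [Real.exp_eq_exp_ℝ]
  rw [h1, Matrix.exp_conj _ _ hU, Matrix.exp_diagonal, h2, hinv, hdiag, Matrix.mul_fin_two,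
    Matrix.mul_fin_two]
  ext i j
  fin_cases i <;> fin_cases j <;> simp [Real.cosh_eq, Real.sinh_eq] <;> ring

/-! ## Lattices -/

/-- A lattice in a topological group: a discrete subgroup `L` such that the quotient carries a
nonzero finite Borel measure that is invariant under `G`.  (Mathlib's `G ⧸ L` consists of the
cosets `gL`, with `G` acting from the left; inversion identifies it with `L\G`, on which `G` acts
from the right.) -/
def IsLatticeSubgroup {G : Type*} [Group G] [TopologicalSpace G] (L : Subgroup G) : Prop :=
  DiscreteTopology L ∧
    letI : MeasurableSpace (G ⧸ L) := borel (G ⧸ L)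
    ∃ μ : MeasureTheory.Measure (G ⧸ L),
      MeasureTheory.IsFiniteMeasure μ ∧ μ ≠ 0 ∧ MeasureTheory.SMulInvariantMeasure G (G ⧸ L) μ

/-! ## The Heisenberg group -/

/-- The three-dimensional Heisenberg group. -/
@[ext] structure HeisenbergGroup where
  z : ℝ
  ξ : ℝ × ℝ

namespace HeisenbergGroup

instance : TopologicalSpace HeisenbergGroup :=
  TopologicalSpace.induced (fun h : HeisenbergGroup => (h.z, h.ξ)) inferInstance

instance : Mul HeisenbergGroup :=
  ⟨fun h k => ⟨h.z + k.z + 1 / 2 * omegaForm h.ξ k.ξ, h.ξ + k.ξ⟩⟩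

instance : One HeisenbergGroup := ⟨⟨0, 0⟩⟩

instance : Inv HeisenbergGroup := ⟨fun h => ⟨-h.z, -h.ξ⟩⟩

@[simp] theorem mul_z (h k : HeisenbergGroup) :
    (h * k).z = h.z + k.z + 1 / 2 * omegaForm h.ξ k.ξ := rfl
@[simp] theorem mul_ξ (h k : HeisenbergGroup) : (h * k).ξ = h.ξ + k.ξ := rfl
@[simp] theorem one_z : (1 : HeisenbergGroup).z = 0 := rfl
@[simp] theorem one_ξ : (1 : HeisenbergGroup).ξ = 0 := rfl
@[simp] theorem inv_z (h : HeisenbergGroup) : (h⁻¹).z = -h.z := rfl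
@[simp] theorem inv_ξ (h : HeisenbergGroup) : (h⁻¹).ξ = -h.ξ := rfl

instance : Group HeisenbergGroup :=
  Group.ofLeftAxioms
    (by
      intro a b c
      ext <;> simp [omegaForm] <;> ring)
    (by
      intro a
      ext <;> simp [omegaForm])
    (by
      intro a
      ext <;> simp [omegaForm])

end HeisenbergGroup

/-! ## The split oscillator group -/

/-- The split oscillator group `Osc = H ⋊ ℝ`, where `t` acts by `t.(z, ξ) = (z, e^{tA} ξ)`. -/
@[ext] structure Osc where
  z : ℝ
  ξ : ℝ × ℝ
  t : ℝ

/-- The coordinate space of `Osc`; it also serves as its tangent spaces and as its Lie algebra. -/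
abbrev OscModel : Type := ℝ × (ℝ × ℝ) × ℝ

namespace Osc

/-- The global chart of `Osc`. -/
def chart : Osc ≃ OscModel where
  toFun q := (q.z, q.ξ, q.t)
  invFun u := ⟨u.1, u.2.1, u.2.2⟩
  left_inv _ := rfl
  right_inv _ := rfl

instance : TopologicalSpace Osc := TopologicalSpace.induced chart inferInstance

instance : Mul Osc :=
  ⟨fun q r => ⟨q.z + r.z + 1 / 2 * omegaForm q.ξ (hypRot q.t r.ξ), q.ξ + hypRot q.t r.ξ, q.t + r.t⟩⟩

instance : One Osc := ⟨⟨0, 0, 0⟩⟩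

instance : Inv Osc := ⟨fun q => ⟨-q.z, -hypRot (-q.t) q.ξ, -q.t⟩⟩

@[simp] theorem mul_z (q r : Osc) :
    (q * r).z = q.z + r.z + 1 / 2 * omegaForm q.ξ (hypRot q.t r.ξ) := rfl
@[simp] theorem mul_ξ (q r : Osc) : (q * r).ξ = q.ξ + hypRot q.t r.ξ := rfl
@[simp] theorem mul_t (q r : Osc) : (q * r).t = q.t + r.t := rfl
@[simp] theorem one_z : (1 : Osc).z = 0 := rfl
@[simp] theorem one_ξ : (1 : Osc).ξ = 0 := rfl
@[simp] theorem one_t : (1 : Osc).t = 0 := rfl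
@[simp] theorem inv_z (q : Osc) : (q⁻¹).z = -q.z := rfl
@[simp] theorem inv_ξ (q : Osc) : (q⁻¹).ξ = -hypRot (-q.t) q.ξ := rfl
@[simp] theorem inv_t (q : Osc) : (q⁻¹).t = -q.t := rfl

instance : Group Osc :=
  Group.ofLeftAxioms
    (by
      intro a b c
      have h := Real.cosh_sq a.t
      ext
      · simp [omegaForm, hypRot, Real.cosh_add, Real.sinh_add]
        linear_combination
          (1 / 2 * (b.ξ.1 * (Real.sinh b.t * c.ξ.1 + Real.cosh b.t * c.ξ.2)
            - b.ξ.2 * (Real.cosh b.t * c.ξ.1 + Real.sinh b.t * c.ξ.2))) * h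
      · simp [hypRot, Real.cosh_add, Real.sinh_add]; ring
      · simp [hypRot, Real.cosh_add, Real.sinh_add]; ring
      · simp; ring)
    (by
      intro a
      ext <;> simp [omegaForm, hypRot])
    (by
      intro a
      ext <;> simp [omegaForm, hypRot] <;> ring)

/-- The expression in coordinates of a self-map of `Osc`. -/
def rep (f : Osc → Osc) : OscModel → OscModel := fun u => chart (f (chart.symm u))

/-- The `ad`-invariant inner product on the Lie algebra of `Osc`:
`⟨(Z, X, T), (Z', X', T')⟩ = ⟨X, X'⟩₀ + Z T' + Z' T` with `⟨·,·⟩₀ = diag(-1, 1)`. -/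
def lieInner (u v : OscModel) : ℝ :=
  (-(u.2.1.1 * v.2.1.1) + u.2.1.2 * v.2.1.2) + u.1 * v.2.2 + v.1 * u.2.2

/-- The bi-invariant pseudo-Riemannian metric of signature `(2, 2)` on `Osc`: the left-invariant
metric that equals `lieInner` at the unit element. -/
def metric (q : Osc) (u v : OscModel) : ℝ :=
  lieInner (fderiv ℝ (rep fun x => q⁻¹ * x) (chart q) u)
    (fderiv ℝ (rep fun x => q⁻¹ * x) (chart q) v)

/-- The isometry group of the pseudo-Riemannian symmetric space `X = Osc`: the diffeomorphisms
that preserve the metric. -/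
def isometryGroup : Subgroup (Equiv.Perm Osc) where
  carrier := {f | ContDiff ℝ ∞ (rep f) ∧ ContDiff ℝ ∞ (rep f.symm) ∧
    ∀ (q : Osc) (u v : OscModel),
      metric (f q) (fderiv ℝ (rep f) (chart q) u) (fderiv ℝ (rep f) (chart q) v) = metric q u v}
  one_mem' := by
    refine ⟨contDiff_id, contDiff_id, fun q u v => ?_⟩
    change metric q (fderiv ℝ id (chart q) u) (fderiv ℝ id (chart q) v) = metric q u v
    simp
  mul_mem' := by
    rintro f g ⟨hf, hf', hfm⟩ ⟨hg, hg', hgm⟩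
    refine ⟨hf.comp hg, hg'.comp hf', fun q u v => ?_⟩
    have h : rep (f * g : Equiv.Perm Osc) = rep f ∘ rep g := rfl
    have hq : rep g (chart q) = chart (g q) := rfl
    rw [h, fderiv_comp _ (hf.differentiable (by simp)).differentiableAt
      (hg.differentiable (by simp)).differentiableAt, hq]
    simp only [ContinuousLinearMap.comp_apply, Equiv.Perm.mul_apply]
    rw [hfm, hgm]
  inv_mem' := by
    rintro f ⟨hf, hf', hfm⟩
    refine ⟨hf', hf, fun q u v => ?_⟩
    have hc : rep f ∘ rep f.symm = id := by
      funext u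
      simp [rep]
    have hq : rep f.symm (chart q) = chart (f.symm q) := rfl
    have hd : ∀ w, fderiv ℝ (rep f) (chart (f.symm q)) (fderiv ℝ (rep f.symm) (chart q) w) = w := by
      intro w
      have h := fderiv_comp (chart q) (hf.differentiable (by simp)).differentiableAt
        (hf'.differentiable (by simp)).differentiableAt
      rw [hc, hq, fderiv_id] at h
      exact (DFunLike.congr_fun h w).symm
    have h := hfm (f.symm q) (fderiv ℝ (rep f.symm) (chart q) u) (fderiv ℝ (rep f.symm) (chart q) v)
    rw [hd, hd, Equiv.apply_symm_apply] at h
    exact h.symm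

end Osc

/-! ## The unity component `G` of the isometry group -/

/-- The group `G = Osc_{2,0}(1,1) ⋊ ℝ = H₂ ⋊ (ℝ ⊕ ℝ)` with elements `(z, ξ₁, ξ₂, t, s)`: here `H₂` is
the five-dimensional Heisenberg group with cocycle `½ (ω(ξ₁, ξ₁') - ω(ξ₂, ξ₂'))`, `t` acts on it by
`e^{tA}` on both planes, and `s` acts by `e^{sφ}` where `φ(ξ₁, ξ₂) = (ξ₂, ξ₁)`. -/
@[ext] structure OscIsom where
  z : ℝ
  ξ₁ : ℝ × ℝ
  ξ₂ : ℝ × ℝ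
  t : ℝ
  s : ℝ

namespace OscIsom

instance : TopologicalSpace OscIsom :=
  TopologicalSpace.induced (fun g : OscIsom => (g.z, g.ξ₁, g.ξ₂, g.t, g.s)) inferInstance

/-- First component of `e^{tA} e^{sφ} (ξ₁, ξ₂)`; note `e^{sφ} = cosh s + sinh s φ`. -/
def act₁ (t s : ℝ) (ξ₁ ξ₂ : ℝ × ℝ) : ℝ × ℝ := hypRot t (Real.cosh s • ξ₁ + Real.sinh s • ξ₂)

/-- Second component of `e^{tA} e^{sφ} (ξ₁, ξ₂)`. -/
def act₂ (t s : ℝ) (ξ₁ ξ₂ : ℝ × ℝ) : ℝ × ℝ := hypRot t (Real.sinh s • ξ₁ + Real.cosh s • ξ₂)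

instance : Mul OscIsom :=
  ⟨fun g h =>
    ⟨g.z + h.z + 1 / 2 * (omegaForm g.ξ₁ (act₁ g.t g.s h.ξ₁ h.ξ₂)
        - omegaForm g.ξ₂ (act₂ g.t g.s h.ξ₁ h.ξ₂)),
      g.ξ₁ + act₁ g.t g.s h.ξ₁ h.ξ₂, g.ξ₂ + act₂ g.t g.s h.ξ₁ h.ξ₂, g.t + h.t, g.s + h.s⟩⟩

instance : One OscIsom := ⟨⟨0, 0, 0, 0, 0⟩⟩

instance : Inv OscIsom :=
  ⟨fun g => ⟨-g.z, -act₁ (-g.t) (-g.s) g.ξ₁ g.ξ₂, -act₂ (-g.t) (-g.s) g.ξ₁ g.ξ₂, -g.t, -g.s⟩⟩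

@[simp] theorem mul_z (g h : OscIsom) :
    (g * h).z = g.z + h.z + 1 / 2 * (omegaForm g.ξ₁ (act₁ g.t g.s h.ξ₁ h.ξ₂)
        - omegaForm g.ξ₂ (act₂ g.t g.s h.ξ₁ h.ξ₂)) := rfl
@[simp] theorem mul_ξ₁ (g h : OscIsom) : (g * h).ξ₁ = g.ξ₁ + act₁ g.t g.s h.ξ₁ h.ξ₂ := rfl
@[simp] theorem mul_ξ₂ (g h : OscIsom) : (g * h).ξ₂ = g.ξ₂ + act₂ g.t g.s h.ξ₁ h.ξ₂ := rfl
@[simp] theorem mul_t (g h : OscIsom) : (g * h).t = g.t + h.t := rfl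
@[simp] theorem mul_s (g h : OscIsom) : (g * h).s = g.s + h.s := rfl
@[simp] theorem one_z : (1 : OscIsom).z = 0 := rfl
@[simp] theorem one_ξ₁ : (1 : OscIsom).ξ₁ = 0 := rfl
@[simp] theorem one_ξ₂ : (1 : OscIsom).ξ₂ = 0 := rfl
@[simp] theorem one_t : (1 : OscIsom).t = 0 := rfl
@[simp] theorem one_s : (1 : OscIsom).s = 0 := rfl
@[simp] theorem inv_z (g : OscIsom) : (g⁻¹).z = -g.z := rfl
@[simp] theorem inv_ξ₁ (g : OscIsom) : (g⁻¹).ξ₁ = -act₁ (-g.t) (-g.s) g.ξ₁ g.ξ₂ := rfl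
@[simp] theorem inv_ξ₂ (g : OscIsom) : (g⁻¹).ξ₂ = -act₂ (-g.t) (-g.s) g.ξ₁ g.ξ₂ := rfl
@[simp] theorem inv_t (g : OscIsom) : (g⁻¹).t = -g.t := rfl
@[simp] theorem inv_s (g : OscIsom) : (g⁻¹).s = -g.s := rfl

instance : Group OscIsom :=
  Group.ofLeftAxioms
    (by
      intro a b c
      ext
      · simp only [mul_z, mul_ξ₁, mul_ξ₂, mul_t, mul_s, omegaForm, act₁, act₂, hypRot, Prod.fst_add,
          Prod.snd_add, Prod.smul_fst, Prod.smul_snd, smul_eq_mul, Real.cosh_eq, Real.sinh_eq,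
          neg_add, Real.exp_add, Real.exp_neg]
        field_simp
        ring
      all_goals
        simp [act₁, act₂, hypRot, Real.cosh_add, Real.sinh_add]; ring)
    (by
      intro a
      ext <;> simp [omegaForm, act₁, act₂, hypRot])
    (by
      intro a
      ext <;> simp [omegaForm, act₁, act₂, hypRot] <;> ring)

/-- The isometric action of `G` on `X = Osc`.  The element `(z, ξ₁, ξ₂, t, s)` acts by
`x ↦ q₁ x q₂⁻¹` with `q₁ = (2z, ξ₁ + Aξ₂, t + s)` and `q₂⁻¹ = (0, 0, t - s) (0, conj(ξ₁ - Aξ₂), 0)`. -/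
instance : MulAction OscIsom Osc where
  smul g x := ⟨2 * g.z, g.ξ₁ + swapA g.ξ₂, g.t + g.s⟩ * x *
    (⟨0, 0, g.t - g.s⟩ * ⟨0, planeConj (g.ξ₁ - swapA g.ξ₂), 0⟩)
  one_smul x := by
    change (⟨2 * (1 : OscIsom).z, _, _⟩ * x * _ : Osc) = x
    ext <;> simp [omegaForm, hypRot, swapA, planeConj]
  mul_smul g h x := by
    change (⟨2 * (g * h).z, _, _⟩ * x * _ : Osc) = ⟨2 * g.z, _, _⟩ * (⟨2 * h.z, _, _⟩ * x * _) * _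
    ext
    case t =>
      simp
      ring
    all_goals
      simp only [mul_z, mul_ξ₁, mul_ξ₂, mul_t, mul_s, omegaForm, act₁, act₂, hypRot, Prod.fst_add,
        Prod.snd_add, Prod.smul_fst, Prod.smul_snd, smul_eq_mul, Real.cosh_eq, Real.sinh_eq,
        neg_add, neg_sub, Real.exp_add, Real.exp_sub, Real.exp_neg, Osc.mul_z, Osc.mul_ξ,
        Osc.mul_t, swapA, planeConj, Prod.fst_sub, Prod.snd_sub, Prod.fst_zero, Prod.snd_zero,
        mul_zero, zero_mul, add_zero, zero_add, sub_zero]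
      field_simp
      ring

theorem smul_def (g : OscIsom) (x : Osc) :
    g • x = ⟨2 * g.z, g.ξ₁ + swapA g.ξ₂, g.t + g.s⟩ * x *
      (⟨0, 0, g.t - g.s⟩ * ⟨0, planeConj (g.ξ₁ - swapA g.ξ₂), 0⟩) := rfl

/-- The stabiliser of the base point is `G₊ = {(0, i y₁, i y₂, 0, s)}`, so `X = G / G₊`. -/
theorem smul_one_eq_one_iff (g : OscIsom) :
    g • (1 : Osc) = 1 ↔ g.z = 0 ∧ g.ξ₁.1 = 0 ∧ g.ξ₂.1 = 0 ∧ g.t = 0 := by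
  have key : ∀ c s : ℝ, ∀ ξ : ℝ × ℝ, c = -s → hypRot c (hypRot s ξ) = ξ := by
    rintro c s ξ rfl
    have h := Real.cosh_sq s
    ext
    · simp [hypRot]
      linear_combination ξ.1 * h
    · simp [hypRot]
      linear_combination ξ.2 * h
  rw [smul_def, Osc.ext_iff]
  constructor
  · rintro ⟨hz, hξ, ht⟩
    have ht0 : g.t = 0 := by
      simp at ht
      linarith
    have h1 : ∀ η : ℝ × ℝ, hypRot (g.t + g.s) (hypRot (g.t - g.s) η) = η :=
      fun η => key _ _ η (by rw [ht0]; ring)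
    have h0 : ∀ c, hypRot c 0 = 0 := fun c => by simp [hypRot]
    simp [h1] at hξ hz
    have e1 := congrArg Prod.fst hξ
    have e2 := congrArg Prod.snd hξ
    simp [swapA, planeConj] at e1 e2
    have a1 : g.ξ₁.1 = 0 := by linarith
    have a2 : g.ξ₂.1 = 0 := by linarith
    refine ⟨?_, a1, a2, ht0⟩
    simp [omegaForm, swapA, planeConj, a1, a2] at hz
    linarith
  · rintro ⟨hz, h1, h2, ht⟩
    have h1' : ∀ η : ℝ × ℝ, hypRot (g.t + g.s) (hypRot (g.t - g.s) η) = η :=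
      fun η => key _ _ η (by rw [ht]; ring)
    have h0 : ∀ c, hypRot c 0 = 0 := fun c => by simp [hypRot]
    refine ⟨?_, ?_, ?_⟩
    · simp [h1', hz, omegaForm, swapA, planeConj, h1, h2]
    · simp only [Osc.mul_ξ, Osc.mul_t, Osc.one_ξ, Osc.one_t, h0, add_zero, zero_add, h1']
      ext <;> simp [swapA, planeConj, h1, h2]
    · simp [ht]

/-- The embedding `ι : Osc → G`, `(2z, 2ξ, 2t) ↦ (z, ξ, Aξ, t, t)`. -/
def iota : Osc →* OscIsom where
  toFun q := ⟨q.z / 2, (1 / 2 : ℝ) • q.ξ, (1 / 2 : ℝ) • swapA q.ξ, q.t / 2, q.t / 2⟩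
  map_one' := by
    ext <;> simp [swapA]
  map_mul' q r := by
    have h : q.t = q.t / 2 + q.t / 2 := by ring
    have hc : Real.cosh q.t = Real.cosh (q.t / 2) ^ 2 + Real.sinh (q.t / 2) ^ 2 := by
      conv_lhs => rw [h, Real.cosh_add]
      ring
    have hs : Real.sinh q.t = 2 * Real.sinh (q.t / 2) * Real.cosh (q.t / 2) := by
      conv_lhs => rw [h, Real.sinh_add]
      ring
    ext <;> simp [omegaForm, act₁, act₂, hypRot, swapA, hc, hs] <;> ring

/-- Through `ι`, the group `Osc` acts on `X = Osc` by left translations. -/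
theorem iota_smul (q x : Osc) : iota q • x = q * x := by
  have h1 : (1 / 2 : ℝ) • q.ξ + swapA ((1 / 2 : ℝ) • swapA q.ξ) = q.ξ := by
    ext <;> simp [swapA] <;> ring
  have h2 : planeConj ((1 / 2 : ℝ) • q.ξ - swapA ((1 / 2 : ℝ) • swapA q.ξ)) = 0 := by
    ext <;> simp [swapA, planeConj]
  have h3 : (⟨0, 0, 0⟩ : Osc) = 1 := rfl
  have h4 : 2 * (q.z / 2) = q.z := by ring
  rw [smul_def]
  simp only [iota, MonoidHom.coe_mk, OneHom.coe_mk, h1, h2, h4, add_halves, sub_self, h3, mul_one]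

/-- The projection `p : G = H₂ ⋊ (ℝ ⊕ ℝ) → ℝ`, `(z, ξ₁, ξ₂, t, s) ↦ t`. -/
def proj (g : OscIsom) : ℝ := g.t

/-- The quotient `Γ\X` is a compact quotient of the symmetric space `X = Osc`: `Γ` is a discrete
group of isometries that acts freely and properly on `X`, and the orbit space is compact. -/
structure IsCompactQuotient (Γ : Subgroup OscIsom) : Prop where
  isometric : Γ.map (MulAction.toPermHom OscIsom Osc) ≤ Osc.isometryGroup
  discrete : DiscreteTopology Γ
  free : ∀ γ ∈ Γ, ∀ x : Osc, γ • x = x → γ = 1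
  proper : ProperSMul Γ Osc
  compact : CompactSpace (Quotient (MulAction.orbitRel Γ Osc))

/-- The quotient `Γ\X` is straight if `p(Γ)` is a discrete subset of `ℝ`. -/
def IsStraight (Γ : Subgroup OscIsom) : Prop :=
  IsDiscrete (proj '' (Γ : Set OscIsom))

theorem act_N (t : ℝ) (ξ : ℝ × ℝ) :
    act₁ t t ξ (-swapA ξ) = ξ ∧ act₂ t t ξ (-swapA ξ) = -swapA ξ := by
  have h := Real.cosh_sq t
  refine ⟨?_, ?_⟩
  · ext
    · simp [act₁, hypRot, swapA]
      linear_combination ξ.1 * h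
    · simp [act₁, hypRot, swapA]
      linear_combination ξ.2 * h
  · ext
    · simp [act₂, hypRot, swapA]
      linear_combination (-ξ.2) * h
    · simp [act₂, hypRot, swapA]
      linear_combination (-ξ.1) * h

/-- The subgroup `N = {(z, ξ, -Aξ, t, t)}` of `G`. -/
def subgroupN : Subgroup OscIsom where
  carrier := {g | g.ξ₂ = -swapA g.ξ₁ ∧ g.s = g.t}
  one_mem' := by
    refine ⟨?_, rfl⟩
    ext <;> simp [swapA]
  mul_mem' := by
    rintro g h ⟨hg, hg'⟩ ⟨hh, hh'⟩
    obtain ⟨e₁, e₂⟩ := act_N g.t h.ξ₁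
    refine ⟨?_, ?_⟩
    · rw [mul_ξ₁, mul_ξ₂, hg, hg', hh, e₁, e₂]
      ext <;> simp [swapA] <;> ring
    · rw [mul_s, mul_t, hg', hh']
  inv_mem' := by
    rintro g ⟨hg, hg'⟩
    obtain ⟨e₁, e₂⟩ := act_N (-g.t) g.ξ₁
    refine ⟨?_, ?_⟩
    · rw [inv_ξ₁, inv_ξ₂, hg, hg', e₁, e₂]
      ext <;> simp [swapA]
    · rw [inv_s, inv_t, hg']

/-- The isomorphism of topological groups `H × ℝ ≃ N`, `((z, ξ), t) ↦ (2z, ξ, -Aξ, t, t)`.  Under it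
the projection to the `ℝ`-factor corresponds to `p` restricted to `N`. -/
def equivN : (HeisenbergGroup × Multiplicative ℝ) ≃ₜ* subgroupN where
  toFun x := ⟨⟨2 * x.1.z, x.1.ξ, -swapA x.1.ξ, x.2.toAdd, x.2.toAdd⟩, rfl, rfl⟩
  invFun n := (⟨n.1.z / 2, n.1.ξ₁⟩, Multiplicative.ofAdd n.1.t)
  left_inv x := by
    refine Prod.ext ?_ rfl
    ext <;> simp
  right_inv n := by
    obtain ⟨n, h₁, h₂⟩ := n
    refine Subtype.ext ?_
    ext <;> simp [h₁, h₂] <;> ring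
  map_mul' x y := by
    obtain ⟨e₁, e₂⟩ := act_N x.2.toAdd y.1.ξ
    refine Subtype.ext (OscIsom.ext ?_ ?_ ?_ rfl rfl)
    · simp only [Subgroup.coe_mul, mul_z, e₁, e₂]
      simp [omegaForm, swapA]
      ring
    · simp only [Subgroup.coe_mul, mul_ξ₁, e₁]
      rfl
    · simp only [Subgroup.coe_mul, mul_ξ₂, e₂]
      ext <;> simp [swapA] <;> ring
  continuous_toFun := by
    have h : Continuous fun k : HeisenbergGroup => (k.z, k.ξ) := continuous_induced_dom
    have hz : Continuous fun x : HeisenbergGroup × Multiplicative ℝ => x.1.z :=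
      (h.comp continuous_fst).fst
    have hξ : Continuous fun x : HeisenbergGroup × Multiplicative ℝ => x.1.ξ :=
      (h.comp continuous_fst).snd
    have ht : Continuous fun x : HeisenbergGroup × Multiplicative ℝ => x.2.toAdd :=
      continuous_toAdd.comp continuous_snd
    refine Continuous.subtype_mk (continuous_induced_rng.2 ?_) _
    exact (continuous_const.mul hz).prodMk
      (hξ.prodMk ((hξ.snd.prodMk hξ.fst).neg.prodMk (ht.prodMk ht)))
  continuous_invFun := by
    have h : Continuous fun g : OscIsom => (g.z, g.ξ₁, g.ξ₂, g.t, g.s) := continuous_induced_dom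
    have h' := h.comp (continuous_subtype_val (p := fun g => g ∈ subgroupN))
    refine Continuous.prodMk (continuous_induced_rng.2 ?_) ?_
    · exact (h'.fst.div_const 2).prodMk h'.snd.fst
    · exact continuous_ofAdd.comp h'.snd.snd.snd.fst

end OscIsom

end

open scoped Matrix ContDiff Pointwise

/-! ## Topology of the groups -/

/-! Both `Osc`, through `ι`, and `N` act simply transitively on `X`, so in either case the inverse
orbit map is a continuous map `s : X → G` with `s (γ • x) = γ * s x`. For a discrete subgroup this
makes the action free and proper, and compactness of the quotient follows from a compact set met by
every orbit (`isCompactQuotient_of_equivariant`). The action is isometric because left and right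
translations both preserve the metric.

For a lattice `L` of `Osc`, cocompactness has to be extracted from finite covolume. Recurrence
(`IsLatticeSubgroup.exists_mul_mul_eq`) gives `γ ∈ L` with large `t`, and `δ ∈ L` with small `t`
whose coordinates along both eigenvectors of `A` are large. Their commutator `k` lies in `H` and has
both eigencoordinates nonzero. Conjugation by `γ` stretches one and shrinks the other, so `k` and
its conjugate do not commute and their commutator is a nontrivial central element of `L`. Powers of
`γ`, of these two elements and of the central one bound `t`, `ξ` and `z` in turn, which gives a
compact set met by every orbit.

For straightness, `t` can be read off from the factor `e^t` by which conjugation scales the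
expanding coordinate of `k`. For bounded `t` the conjugates of `k`, corrected by central elements of
`L`, stay in a compact set. Discreteness of `L` leaves finitely many of them, hence finitely many
values of `t` (`Osc.finite_image_t`).

For the second claim, shear the product of an integral Heisenberg lattice and `ℤ` by the
homomorphism `(z, ξ) ↦ √2 ξ.1`. The result is still discrete with a box as strict fundamental
domain, but its projection to the line is `ℤ + √2 ℤ`, which is dense. Since `p` on `N` is that
projection, the quotient is not straight. -/

theorem continuous_omegaForm : Continuous fun p : (ℝ × ℝ) × (ℝ × ℝ) => omegaForm p.1 p.2 := by
  unfold omegaForm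
  fun_prop

theorem continuous_hypRot : Continuous fun p : ℝ × (ℝ × ℝ) => hypRot p.1 p.2 := by
  unfold hypRot
  fun_prop

theorem continuous_swapA : Continuous swapA := by
  unfold swapA
  fun_prop

theorem continuous_planeConj : Continuous planeConj := by
  unfold planeConj
  fun_prop

namespace HeisenbergGroup

/-- The global chart of the Heisenberg group, as a homeomorphism. -/
def homeo : HeisenbergGroup ≃ₜ ℝ × (ℝ × ℝ) where
  toFun h := (h.z, h.ξ)
  invFun u := ⟨u.1, u.2⟩
  left_inv _ := rfl
  right_inv _ := rfl
  continuous_toFun := continuous_induced_dom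
  continuous_invFun := continuous_induced_rng.2 continuous_id

@[fun_prop] theorem continuous_z : Continuous HeisenbergGroup.z := homeo.continuous.fst
@[fun_prop] theorem continuous_ξ : Continuous HeisenbergGroup.ξ := homeo.continuous.snd

instance : IsTopologicalGroup HeisenbergGroup where
  continuous_mul := by
    refine continuous_induced_rng.2 (Continuous.prodMk ?_ ?_)
    · have h := continuous_omegaForm.comp
        ((continuous_ξ.comp (continuous_fst (X := HeisenbergGroup) (Y := HeisenbergGroup))).prodMk
          (continuous_ξ.comp continuous_snd))
      simp only [mul_z]
      exact ((continuous_z.comp continuous_fst).add (continuous_z.comp continuous_snd)).add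
        (continuous_const.mul h)
    · simp only [mul_ξ]
      fun_prop
  continuous_inv := by
    refine continuous_induced_rng.2 (Continuous.prodMk ?_ ?_)
    · simp only [inv_z]
      fun_prop
    · simp only [inv_ξ]
      fun_prop

end HeisenbergGroup

namespace Osc

/-- The global chart of `Osc`, as a homeomorphism. -/
def homeo : Osc ≃ₜ OscModel where
  toEquiv := chart
  continuous_toFun := continuous_induced_dom
  continuous_invFun := continuous_induced_rng.2 continuous_id

@[fun_prop] theorem continuous_z : Continuous Osc.z := homeo.continuous.fst
@[fun_prop] theorem continuous_ξ : Continuous Osc.ξ := homeo.continuous.snd.fst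
@[fun_prop] theorem continuous_t : Continuous Osc.t := homeo.continuous.snd.snd

theorem continuous_mk {Y : Type*} [TopologicalSpace Y] {z : Y → ℝ} {ξ : Y → ℝ × ℝ} {t : Y → ℝ}
    (hz : Continuous z) (hξ : Continuous ξ) (ht : Continuous t) :
    Continuous fun y => (⟨z y, ξ y, t y⟩ : Osc) :=
  continuous_induced_rng.2 (hz.prodMk (hξ.prodMk ht))

instance : T2Space Osc := homeo.isEmbedding.t2Space
instance : SecondCountableTopology Osc := homeo.isEmbedding.secondCountableTopology
instance : LocallyCompactSpace Osc := homeo.isClosedEmbedding.locallyCompactSpace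

instance : IsTopologicalGroup Osc where
  continuous_mul := by
    have hr : Continuous fun p : Osc × Osc => hypRot p.1.t p.2.ξ :=
      continuous_hypRot.comp (f := fun p : Osc × Osc => (p.1.t, p.2.ξ)) (by fun_prop)
    have ho : Continuous fun p : Osc × Osc => omegaForm p.1.ξ (hypRot p.1.t p.2.ξ) :=
      continuous_omegaForm.comp (f := fun p : Osc × Osc => (p.1.ξ, hypRot p.1.t p.2.ξ))
        (Continuous.prodMk (by fun_prop) hr)
    exact continuous_mk (((continuous_z.comp continuous_fst).add
      (continuous_z.comp continuous_snd)).add (continuous_const.mul ho))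
      ((continuous_ξ.comp continuous_fst).add hr)
      ((continuous_t.comp continuous_fst).add (continuous_t.comp continuous_snd))
  continuous_inv := by
    have hr : Continuous fun p : Osc => hypRot (-p.t) p.ξ :=
      continuous_hypRot.comp (f := fun p : Osc => (-p.t, p.ξ)) (by fun_prop)
    exact continuous_mk continuous_z.neg hr.neg continuous_t.neg

/-! ### Isometries of `Osc` -/

theorem hasDerivAt_line (x u : ℝ) : HasDerivAt (fun s : ℝ => x + s * u) u 0 := by
  simpa using ((hasDerivAt_id (0 : ℝ)).mul_const u).const_add x

theorem fderiv_apply_eq_of_hasDerivAt {f : OscModel → OscModel} (hf : ContDiff ℝ ∞ f)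
    {p u D : OscModel} (h : HasDerivAt (fun s : ℝ => f (p + s • u)) D 0) :
    fderiv ℝ f p u = D := by
  rw [← (hf.differentiable (by simp)).differentiableAt.lineDeriv_eq_fderiv]
  exact h.deriv

theorem contDiff_rep_mul (q r : Osc) : ContDiff ℝ ∞ (rep fun x => q * x * r) := by
  unfold rep chart
  simp only [Equiv.coe_fn_mk, Equiv.coe_fn_symm_mk, mul_z, mul_ξ, mul_t, omegaForm, hypRot,
    Prod.fst_add, Prod.snd_add]
  fun_prop

theorem contDiff_rep_mul_left (q : Osc) : ContDiff ℝ ∞ (rep fun x => q * x) := by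
  simpa using contDiff_rep_mul q 1

theorem contDiff_rep_mul_right (q : Osc) : ContDiff ℝ ∞ (rep fun x => x * q) := by
  simpa using contDiff_rep_mul 1 q

theorem fderiv_rep_mul_left (q : Osc) (p u : OscModel) :
    fderiv ℝ (rep fun x => q * x) p u =
      (u.1 + 1 / 2 * omegaForm q.ξ (hypRot q.t u.2.1), hypRot q.t u.2.1, u.2.2) := by
  refine fderiv_apply_eq_of_hasDerivAt (contDiff_rep_mul_left q) ?_
  have h1 := hasDerivAt_line p.2.1.1 u.2.1.1
  have h2 := hasDerivAt_line p.2.1.2 u.2.1.2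
  have ha := ((h1.const_mul (Real.cosh q.t)).add (h2.const_mul (Real.sinh q.t)))
  have hb := ((h1.const_mul (Real.sinh q.t)).add (h2.const_mul (Real.cosh q.t)))
  refine HasDerivAt.prodMk ?_ (HasDerivAt.prodMk (HasDerivAt.prodMk ?_ ?_) ?_)
  · exact ((hasDerivAt_line p.1 u.1).const_add q.z).add
      (((hb.const_mul q.ξ.1).sub (ha.mul_const q.ξ.2)).const_mul (1 / 2))
  · exact ha.const_add q.ξ.1
  · exact hb.const_add q.ξ.2
  · exact (hasDerivAt_line p.2.2 u.2.2).const_add q.t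

theorem fderiv_rep_mul_right (r : Osc) (p u : OscModel) :
    fderiv ℝ (rep fun x => x * r) p u =
      (u.1 + 1 / 2 * (omegaForm u.2.1 (hypRot p.2.2 r.ξ) +
          u.2.2 * omegaForm p.2.1 (swapA (hypRot p.2.2 r.ξ))),
        u.2.1 + u.2.2 • swapA (hypRot p.2.2 r.ξ), u.2.2) := by
  refine fderiv_apply_eq_of_hasDerivAt (contDiff_rep_mul_right r) ?_
  have h1 := hasDerivAt_line p.2.1.1 u.2.1.1
  have h2 := hasDerivAt_line p.2.1.2 u.2.1.2
  have h3 := hasDerivAt_line p.2.2 u.2.2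
  have ha := (h3.cosh.mul_const r.ξ.1).add (h3.sinh.mul_const r.ξ.2)
  have hb := (h3.sinh.mul_const r.ξ.1).add (h3.cosh.mul_const r.ξ.2)
  have hw := ((hasDerivAt_line p.1 u.1).add_const r.z).add
    (((h1.mul hb).sub (ha.mul h2)).const_mul (1 / 2))
  refine HasDerivAt.prodMk ?_ (HasDerivAt.prodMk (HasDerivAt.prodMk ?_ ?_) ?_)
  · convert! hw using 1
    simp [omegaForm, hypRot, swapA]
    ring
  · convert! h1.add ha using 1
    simp [hypRot, swapA]
    ring
  · convert! h2.add hb using 1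
    simp [hypRot, swapA]
    ring
  · exact h3.add_const r.t

/-- Translating back to the unit applies `e^{-tA}`, which preserves both `ω` and `diag(-1, 1)`, so
`t` drops out of the metric. -/
theorem metric_eq (q : Osc) (u v : OscModel) :
    metric q u v = -(u.2.1.1 * v.2.1.1) + u.2.1.2 * v.2.1.2 +
      (u.1 - 1 / 2 * omegaForm q.ξ u.2.1) * v.2.2 +
      (v.1 - 1 / 2 * omegaForm q.ξ v.2.1) * u.2.2 := by
  have h := Real.cosh_sq q.t
  rw [metric, fderiv_rep_mul_left, fderiv_rep_mul_left]
  simp only [lieInner, omegaForm, inv_ξ, inv_t, hypRot, Prod.fst_neg, Prod.snd_neg, Real.cosh_neg,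
    Real.sinh_neg]
  linear_combination (-(u.2.1.1 * v.2.1.1) + u.2.1.2 * v.2.1.2 -
      (1 / 2 * (q.ξ.1 * u.2.1.2 - u.2.1.1 * q.ξ.2)) * v.2.2 -
      (1 / 2 * (q.ξ.1 * v.2.1.2 - v.2.1.1 * q.ξ.2)) * u.2.2) * h

theorem mulLeft_mem_isometryGroup (q : Osc) : Equiv.mulLeft q ∈ isometryGroup := by
  refine ⟨contDiff_rep_mul_left q, contDiff_rep_mul_left q⁻¹, fun x u v => ?_⟩
  have h := Real.cosh_sq q.t
  have e : ∀ w, fderiv ℝ (rep (Equiv.mulLeft q)) (chart x) w = _ :=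
    fun w => fderiv_rep_mul_left q (chart x) w
  rw [e, e, metric_eq, metric_eq]
  simp only [Equiv.coe_mulLeft, omegaForm, hypRot, mul_ξ, Prod.fst_add, Prod.snd_add]
  linear_combination (-(u.2.1.1 * v.2.1.1) + u.2.1.2 * v.2.1.2 -
      (1 / 2 * (x.ξ.1 * u.2.1.2 - u.2.1.1 * x.ξ.2)) * v.2.2 -
      (1 / 2 * (x.ξ.1 * v.2.1.2 - v.2.1.1 * x.ξ.2)) * u.2.2) * h

/-- This is the bi-invariance of the metric: the terms in `Aη`, with `η = e^{tA} r.ξ`, that enter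
through the derivative of `e^{tA}` cancel against the change of the `ω` terms. -/
theorem mulRight_mem_isometryGroup (r : Osc) : Equiv.mulRight r ∈ isometryGroup := by
  refine ⟨contDiff_rep_mul_right r, contDiff_rep_mul_right r⁻¹, fun x u v => ?_⟩
  have e : ∀ w, fderiv ℝ (rep (Equiv.mulRight r)) (chart x) w = _ :=
    fun w => fderiv_rep_mul_right r (chart x) w
  rw [e, e, metric_eq, metric_eq]
  have hx : (chart x).2.1 = x.ξ := rfl
  have ht : (chart x).2.2 = x.t := rfl
  simp only [Equiv.coe_mulRight, hx, ht, mul_ξ]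
  generalize hypRot x.t r.ξ = η
  simp [omegaForm, swapA]
  ring

end Osc

/-! ### The topological group `OscIsom` and a criterion for compact quotients -/

namespace OscIsom

/-- The global chart of `OscIsom`, as a homeomorphism. -/
def homeo : OscIsom ≃ₜ ℝ × (ℝ × ℝ) × (ℝ × ℝ) × ℝ × ℝ where
  toFun g := (g.z, g.ξ₁, g.ξ₂, g.t, g.s)
  invFun u := ⟨u.1, u.2.1, u.2.2.1, u.2.2.2.1, u.2.2.2.2⟩
  left_inv _ := rfl
  right_inv _ := rfl
  continuous_toFun := continuous_induced_dom
  continuous_invFun := continuous_induced_rng.2 continuous_id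

@[fun_prop] theorem continuous_z : Continuous OscIsom.z := homeo.continuous.fst
@[fun_prop] theorem continuous_ξ₁ : Continuous OscIsom.ξ₁ := homeo.continuous.snd.fst
@[fun_prop] theorem continuous_ξ₂ : Continuous OscIsom.ξ₂ := homeo.continuous.snd.snd.fst
@[fun_prop] theorem continuous_t : Continuous OscIsom.t := homeo.continuous.snd.snd.snd.fst
@[fun_prop] theorem continuous_s : Continuous OscIsom.s := homeo.continuous.snd.snd.snd.snd

theorem continuous_mk {Y : Type*} [TopologicalSpace Y] {z : Y → ℝ} {ξ₁ ξ₂ : Y → ℝ × ℝ}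
    {t s : Y → ℝ} (hz : Continuous z) (hξ₁ : Continuous ξ₁) (hξ₂ : Continuous ξ₂)
    (ht : Continuous t) (hs : Continuous s) :
    Continuous fun y => (⟨z y, ξ₁ y, ξ₂ y, t y, s y⟩ : OscIsom) :=
  continuous_induced_rng.2 (hz.prodMk (hξ₁.prodMk (hξ₂.prodMk (ht.prodMk hs))))

instance : T2Space OscIsom := homeo.isEmbedding.t2Space

theorem continuous_act₁ :
    Continuous fun p : (ℝ × ℝ) × (ℝ × ℝ) × (ℝ × ℝ) => act₁ p.1.1 p.1.2 p.2.1 p.2.2 := by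
  unfold act₁ hypRot
  fun_prop

theorem continuous_act₂ :
    Continuous fun p : (ℝ × ℝ) × (ℝ × ℝ) × (ℝ × ℝ) => act₂ p.1.1 p.1.2 p.2.1 p.2.2 := by
  unfold act₂ hypRot
  fun_prop

instance : IsTopologicalGroup OscIsom where
  continuous_mul := by
    have hf : Continuous fun p : OscIsom × OscIsom => ((p.1.t, p.1.s), p.2.ξ₁, p.2.ξ₂) := by
      fun_prop
    have h1 := continuous_act₁.comp hf
    have h2 := continuous_act₂.comp hf
    have o1 := continuous_omegaForm.comp
      ((continuous_ξ₁.comp (continuous_fst (X := OscIsom) (Y := OscIsom))).prodMk h1)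
    have o2 := continuous_omegaForm.comp
      ((continuous_ξ₂.comp (continuous_fst (X := OscIsom) (Y := OscIsom))).prodMk h2)
    exact continuous_mk (((continuous_z.comp continuous_fst).add
      (continuous_z.comp continuous_snd)).add (continuous_const.mul (o1.sub o2)))
      ((continuous_ξ₁.comp continuous_fst).add h1) ((continuous_ξ₂.comp continuous_fst).add h2)
      ((continuous_t.comp continuous_fst).add (continuous_t.comp continuous_snd))
      ((continuous_s.comp continuous_fst).add (continuous_s.comp continuous_snd))
  continuous_inv := by
    have hf : Continuous fun p : OscIsom => ((-p.t, -p.s), p.ξ₁, p.ξ₂) := by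
      fun_prop
    exact continuous_mk continuous_z.neg (continuous_act₁.comp hf).neg
      (continuous_act₂.comp hf).neg continuous_t.neg continuous_s.neg

instance : ContinuousConstSMul OscIsom Osc where
  continuous_const_smul g := by
    simp only [smul_def]
    fun_prop

instance (Γ : Subgroup OscIsom) : ContinuousConstSMul Γ Osc where
  continuous_const_smul γ := continuous_const_smul (γ : OscIsom)

theorem map_toPermHom_le_isometryGroup (Γ : Subgroup OscIsom) :
    Γ.map (MulAction.toPermHom OscIsom Osc) ≤ Osc.isometryGroup := by
  rintro _ ⟨g, -, rfl⟩
  have h : MulAction.toPermHom OscIsom Osc g =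
      Equiv.mulRight (⟨0, 0, g.t - g.s⟩ * ⟨0, planeConj (g.ξ₁ - swapA g.ξ₂), 0⟩) *
        Equiv.mulLeft ⟨2 * g.z, g.ξ₁ + swapA g.ξ₂, g.t + g.s⟩ := by
    ext1 x
    exact smul_def g x
  rw [h]
  exact mul_mem (Osc.mulRight_mem_isometryGroup _) (Osc.mulLeft_mem_isometryGroup _)

/-- A discrete subgroup whose elements intertwine a continuous map `s : Osc → OscIsom` with left
multiplication, and which moves every point into a fixed compact set, gives a compact quotient. -/
theorem isCompactQuotient_of_equivariant {Γ : Subgroup OscIsom} [hΓ : DiscreteTopology Γ]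
    {s : Osc → OscIsom} (hs : Continuous s) (heq : ∀ γ ∈ Γ, ∀ x, s (γ • x) = γ * s x)
    {K : Set Osc} (hK : IsCompact K) (hcov : ∀ x, ∃ γ ∈ Γ, γ • x ∈ K) : IsCompactQuotient Γ where
  isometric := map_toPermHom_le_isometryGroup Γ
  discrete := hΓ
  free γ hγ x hx := by
    have h := heq γ hγ x
    rw [hx] at h
    exact mul_eq_right.1 h.symm
  proper := by
    rw [← properlyDiscontinuousSMul_iff_properSMul]
    refine ⟨fun {C D} hC hD => ?_⟩
    -- If `γ • x ∈ D` with `x ∈ C`, then `γ = s (γ • x) * (s x)⁻¹` lies in this compact set, which a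
    -- discrete, hence closed, subgroup meets in finitely many points.
    have hcpt : IsCompact (s '' D * (s '' C)⁻¹) := (hD.image hs).mul (hC.image hs).inv
    have hfin : (((↑) : Γ → OscIsom) ⁻¹' (s '' D * (s '' C)⁻¹)).Finite :=
      ((Subgroup.isClosed_of_discrete (H := Γ)).isClosedEmbedding_subtypeVal.isCompact_preimage
        hcpt).finite_of_discrete
    refine hfin.subset ?_
    rintro γ ⟨y, ⟨x, hx, rfl⟩, hy⟩
    refine ⟨s (γ • x), Set.mem_image_of_mem s hy, (s x)⁻¹,
      Set.inv_mem_inv.2 (Set.mem_image_of_mem s hx), ?_⟩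
    have h := heq γ γ.2 x
    change s ((γ : OscIsom) • x) * (s x)⁻¹ = γ
    rw [h, mul_inv_cancel_right]
  compact := by
    refine ⟨?_⟩
    have h : (Set.univ : Set (Quotient (MulAction.orbitRel Γ Osc))) = Quotient.mk _ '' K := by
      refine (Set.eq_univ_of_forall fun y => ?_).symm
      induction y using Quotient.inductionOn with
      | h x =>
        obtain ⟨γ, hγ, hx⟩ := hcov x
        exact ⟨γ • x, hx, Quotient.sound (MulAction.orbitRel_apply.2 ⟨⟨γ, hγ⟩, rfl⟩)⟩
    rw [h]
    exact hK.image continuous_quotient_mk'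

end OscIsom

/-- The image of a discrete subgroup under a homomorphism that is a topological embedding is
discrete. -/
theorem Subgroup.discreteTopology_map {G G' : Type*} [Group G] [Group G'] [TopologicalSpace G]
    [TopologicalSpace G'] {f : G →* G'} (hf : Topology.IsEmbedding f) (L : Subgroup G)
    [hL : DiscreteTopology L] : DiscreteTopology (L.map f) := by
  have h : IsDiscrete (L : Set G) := isDiscrete_iff_discreteTopology.2 hL
  exact isDiscrete_iff_discreteTopology.1 (h.image hf.isInducing)

/-! ## Recurrence for lattices -/

open MeasureTheory in
/-- Pigeonhole principle in a group with a lattice: among infinitely many translates of a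
neighbourhood of `1`, two meet modulo the lattice. -/
theorem IsLatticeSubgroup.exists_mul_mul_eq {G : Type*} [Group G] [TopologicalSpace G]
    [IsTopologicalGroup G] [SecondCountableTopology G] {L : Subgroup G} (hL : IsLatticeSubgroup L)
    {U : Set G} (hU : IsOpen U) (h1 : (1 : G) ∈ U) (g : ℕ → G) :
    ∃ i j, i < j ∧ ∃ u ∈ U, ∃ v ∈ U, ∃ l ∈ L, g i * u * l = g j * v := by
  obtain ⟨-, μ, hfin, hμ, hinv⟩ := hL
  let _ : MeasurableSpace (G ⧸ L) := borel (G ⧸ L)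
  have : BorelSpace (G ⧸ L) := ⟨rfl⟩
  set W : Set (G ⧸ L) := QuotientGroup.mk '' U with hW
  have hWo : IsOpen W := QuotientGroup.isOpenMap_coe U hU
  have hmeas : ∀ x : G, MeasurableSet ((fun y : G ⧸ L => x • y) ⁻¹' W) := fun x =>
    (hWo.preimage (continuous_const_smul x)).measurableSet
  have hmu : ∀ x : G, μ ((fun y : G ⧸ L => x • y) ⁻¹' W) = μ W := fun x =>
    hinv.measure_preimage_smul x hWo.measurableSet
  -- Countably many translates of `W` cover the quotient and have equal measure, so a null `W` would
  -- force `μ = 0`.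
  have hpos : μ W ≠ 0 := by
    intro h0
    obtain ⟨D, hDc, hDd⟩ := TopologicalSpace.exists_countable_dense G
    apply hμ
    rw [← Measure.measure_univ_eq_zero]
    have hcov : (Set.univ : Set (G ⧸ L)) ⊆ ⋃ d ∈ D, (fun y : G ⧸ L => d • y) ⁻¹' W := by
      intro y _
      induction y using QuotientGroup.induction_on with
      | H x =>
        have ho : IsOpen ((fun d : G => d * x) ⁻¹' U) := hU.preimage (continuous_mul_const x)
        obtain ⟨d, hd, hdD⟩ := hDd.exists_mem_open ho ⟨x⁻¹, by simpa using h1⟩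
        exact Set.mem_biUnion hd ⟨d * x, hdD, rfl⟩
    refine measure_mono_null hcov ((measure_biUnion_null_iff hDc).2 fun d _ => ?_)
    rw [hmu, h0]
  -- Infinitely many sets of equal positive measure cannot be pairwise disjoint in a space of finite
  -- measure.
  obtain ⟨i, j, hij, x, hxi, hxj⟩ := exists_nonempty_inter_of_measure_univ_lt_tsum_measure μ
    (s := fun n : ℕ => (fun y : G ⧸ L => (g n)⁻¹ • y) ⁻¹' W)
    (fun n => (hmeas _).nullMeasurableSet) (by
      simp_rw [hmu]
      rw [ENNReal.tsum_const_eq_top_of_ne_zero hpos]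
      exact measure_lt_top μ _)
  have key : ∀ i j : ℕ, ∀ x : G ⧸ L, (g i)⁻¹ • x ∈ W → (g j)⁻¹ • x ∈ W →
      ∃ u ∈ U, ∃ v ∈ U, ∃ l ∈ L, g i * u * l = g j * v := by
    rintro i j x ⟨u, hu, hui⟩ ⟨v, hv, hvj⟩
    have h : ((g i * u : G) : G ⧸ L) = ((g j * v : G) : G ⧸ L) := by
      have e1 : ((g i * u : G) : G ⧸ L) = g i • (u : G ⧸ L) := rfl
      have e2 : ((g j * v : G) : G ⧸ L) = g j • (v : G ⧸ L) := rfl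
      rw [e1, e2, hui, hvj, smul_inv_smul, smul_inv_smul]
    exact ⟨u, hu, v, hv, _, QuotientGroup.eq.1 h, by group⟩
  rcases lt_or_gt_of_ne hij with h | h
  · exact ⟨i, j, h, key i j x hxi hxj⟩
  · exact ⟨j, i, h, key j i x hxj hxi⟩

namespace Osc

/-! ## Lattices of the split oscillator group -/

/-- The coordinate of an element along the eigenvector `(1, 1)` of `A`. -/
def expanding (q : Osc) : ℝ := q.ξ.1 + q.ξ.2

/-- The coordinate of an element along the eigenvector `(1, -1)` of `A`. -/
def contracting (q : Osc) : ℝ := q.ξ.1 - q.ξ.2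

theorem expanding_mul (q r : Osc) :
    (q * r).expanding = q.expanding + Real.exp q.t * r.expanding := by
  simp only [expanding, mul_ξ, hypRot, Prod.fst_add, Prod.snd_add]
  rw [← Real.cosh_add_sinh]
  ring

theorem contracting_mul (q r : Osc) :
    (q * r).contracting = q.contracting + Real.exp (-q.t) * r.contracting := by
  simp only [contracting, mul_ξ, hypRot, Prod.fst_add, Prod.snd_add]
  rw [← Real.cosh_sub_sinh]
  ring

theorem expanding_inv (q : Osc) : (q⁻¹).expanding = -(Real.exp (-q.t) * q.expanding) := by
  have h := expanding_mul q⁻¹ q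
  rw [inv_mul_cancel] at h
  simp [expanding] at h ⊢
  linarith

theorem contracting_inv (q : Osc) : (q⁻¹).contracting = -(Real.exp q.t * q.contracting) := by
  have h := contracting_mul q⁻¹ q
  rw [inv_mul_cancel] at h
  simp [contracting] at h ⊢
  linarith

/-- In the eigenbasis of `A`, `ω` pairs only expanding with contracting coordinates. -/
theorem omegaForm_eq (q r : Osc) : omegaForm q.ξ r.ξ =
    1 / 2 * (q.contracting * r.expanding - q.expanding * r.contracting) := by
  simp only [omegaForm, expanding, contracting]
  ring

theorem expanding_conj (g k : Osc) (hk : k.t = 0) :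
    (g * k * g⁻¹).expanding = Real.exp g.t * k.expanding := by
  have h : Real.exp g.t * Real.exp (-g.t) = 1 := by rw [← Real.exp_add]; simp
  simp only [expanding_mul, expanding_inv, mul_t, hk, add_zero]
  linear_combination (-g.expanding) * h

theorem contracting_conj (g k : Osc) (hk : k.t = 0) :
    (g * k * g⁻¹).contracting = Real.exp (-g.t) * k.contracting := by
  have h : Real.exp (-g.t) * Real.exp g.t = 1 := by rw [← Real.exp_add]; simp
  simp only [contracting_mul, contracting_inv, mul_t, hk, add_zero]
  linear_combination (-g.contracting) * h

/-- In the expanding coordinate `Osc` acts on the line by the affine maps `x ↦ e^t x + a`, and this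
is their commutator. The contracting coordinate behaves likewise with `e^{-t}`. -/
theorem expanding_commutator (g h : Osc) : (g * h * g⁻¹ * h⁻¹).expanding =
    (Real.exp g.t - 1) * h.expanding - (Real.exp h.t - 1) * g.expanding := by
  have hg : Real.exp g.t * Real.exp (-g.t) = 1 := by rw [← Real.exp_add]; simp
  have hh : Real.exp h.t * Real.exp (-h.t) = 1 := by rw [← Real.exp_add]; simp
  simp only [expanding_mul, expanding_inv, mul_t, inv_t, Real.exp_add]
  linear_combination (-(Real.exp h.t * g.expanding) -
    Real.exp h.t * Real.exp (-h.t) * h.expanding) * hg - h.expanding * hh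

theorem contracting_commutator (g h : Osc) : (g * h * g⁻¹ * h⁻¹).contracting =
    (Real.exp (-g.t) - 1) * h.contracting - (Real.exp (-h.t) - 1) * g.contracting := by
  have hg : Real.exp (-g.t) * Real.exp g.t = 1 := by rw [← Real.exp_add]; simp
  have hh : Real.exp (-h.t) * Real.exp h.t = 1 := by rw [← Real.exp_add]; simp
  simp only [contracting_mul, contracting_inv, mul_t, inv_t, neg_add, Real.exp_add, neg_neg]
  linear_combination (-(Real.exp (-h.t) * g.contracting) -
    Real.exp h.t * Real.exp (-h.t) * h.contracting) * hg - h.contracting * hh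

theorem exists_mem_one_le_t {L : Subgroup Osc} (hL : IsLatticeSubgroup L) :
    ∃ γ ∈ L, 1 ≤ γ.t := by
  have hU : IsOpen {q : Osc | |q.t| < 1 / 2} := isOpen_lt (by fun_prop) (by fun_prop)
  -- The spacing `2` exceeds by `1` the total error allowed by the two windows of radius `1 / 2`.
  obtain ⟨i, j, hij, u, hu, v, hv, l, hl, h⟩ :=
    hL.exists_mul_mul_eq hU (by simp) (fun n => (⟨0, 0, 2 * n⟩ : Osc))
  refine ⟨l, hl, ?_⟩
  have ht := congrArg Osc.t h
  have hij' : (i : ℝ) + 1 ≤ j := by exact_mod_cast hij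
  simp only [mul_t, Set.mem_ofPred_eq] at ht hu hv
  rw [abs_lt] at hu hv
  linarith

theorem exists_mem_lt_expanding_lt_contracting {L : Subgroup Osc} (hL : IsLatticeSubgroup L)
    {C : ℝ} (hC : 0 ≤ C) : ∃ δ ∈ L, |δ.t| < 1 ∧ C < δ.expanding ∧ C < δ.contracting := by
  have hU : IsOpen {q : Osc | |q.t| < 1 / 2 ∧ |q.expanding| < 1 ∧ |q.contracting| < 1} := by
    simp only [expanding, contracting]
    exact (isOpen_lt (by fun_prop) (by fun_prop)).and
      ((isOpen_lt (by fun_prop) (by fun_prop)).and (isOpen_lt (by fun_prop) (by fun_prop)))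
  -- The direction `(1, 0)` has both eigencoordinates equal to `1`. The spacing `3 * C + 4` loses at
  -- most `2` to `u` and `v`, then at most a factor `3` to `e^{±u.t}`, and still leaves more than
  -- `C`.
  obtain ⟨i, j, hij, u, ⟨hu, hua, hub⟩, v, ⟨hv, hva, hvb⟩, l, hl, h⟩ :=
    hL.exists_mul_mul_eq hU (by simp [expanding, contracting])
      (fun n => (⟨0, (n * (3 * C + 4), 0), 0⟩ : Osc))
  have hij' : (i : ℝ) + 1 ≤ j := by exact_mod_cast hij
  have hR : 3 * C + 4 ≤ j * (3 * C + 4) - i * (3 * C + 4) := by nlinarith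
  have ht := congrArg Osc.t h
  have ha := congrArg Osc.expanding h
  have hb := congrArg Osc.contracting h
  simp only [mul_t, expanding_mul, contracting_mul, zero_add, neg_zero, Real.exp_zero,
    one_mul] at ht ha hb
  simp only [expanding] at ha hua hva ⊢
  simp only [contracting] at hb hub hvb ⊢
  rw [abs_lt] at hu hv hua hva hub hvb
  have key : ∀ s x : ℝ, |s| < 1 / 2 → 3 * C + 2 < Real.exp s * x → C < x := by
    intro s x hs hx
    have h3 : Real.exp s ≤ 3 := by
      have : Real.exp s ≤ Real.exp 1 := Real.exp_le_exp.2 (by linarith [(abs_lt.1 hs).2])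
      linarith [Real.exp_one_lt_d9]
    by_contra! hxC
    nlinarith [Real.exp_pos s]
  refine ⟨l, hl, abs_lt.2 ⟨by linarith, by linarith⟩, key u.t _ (abs_lt.2 hu) (by linarith),
    key (-u.t) _ (by rw [abs_neg]; exact abs_lt.2 hu) (by linarith)⟩

/-- A lattice contains non-commuting elements of the Heisenberg subgroup. -/
theorem exists_mem_omegaForm_ne_zero {L : Subgroup Osc} (hL : IsLatticeSubgroup L) :
    ∃ k₁ ∈ L, ∃ k₂ ∈ L, k₁.t = 0 ∧ k₂.t = 0 ∧ k₁.expanding ≠ 0 ∧ omegaForm k₁.ξ k₂.ξ ≠ 0 := by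
  obtain ⟨γ, hγ, hγt⟩ := exists_mem_one_le_t hL
  -- In the commutator the `δ` terms carry factors of size at least `1` and `1 / 2`, the `γ` terms
  -- factors of size at most `2`. The constant `4` lets `δ` dominate in both coordinates.
  obtain ⟨δ, hδ, hδt, hδa, hδb⟩ := exists_mem_lt_expanding_lt_contracting hL
    (C := 4 * (|γ.expanding| + |γ.contracting|)) (by positivity)
  have hE : 2 ≤ Real.exp γ.t := by linarith [Real.add_one_le_exp γ.t]
  have hE' : Real.exp (-γ.t) ≤ 1 / 2 := by
    rw [Real.exp_neg, ← one_div]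
    exact one_div_le_one_div_of_le (by norm_num) hE
  have hsmall : ∀ s x : ℝ, |s| < 1 → |(Real.exp s - 1) * x| ≤ 2 * |x| := by
    intro s x hs
    have h3 : Real.exp s ≤ 3 := by
      have : Real.exp s ≤ Real.exp 1 := Real.exp_le_exp.2 (abs_lt.1 hs).2.le
      linarith [Real.exp_one_lt_d9]
    rw [abs_mul]
    refine mul_le_mul_of_nonneg_right (abs_le.2 ⟨?_, ?_⟩) (abs_nonneg x)
    · linarith [Real.exp_pos s]
    · linarith
  set k := γ * δ * γ⁻¹ * δ⁻¹ with hk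
  have hkt : k.t = 0 := by simp [hk]
  have hka : k.expanding ≠ 0 := by
    rw [hk, expanding_commutator]
    have h := abs_le.1 (hsmall δ.t γ.expanding hδt)
    nlinarith [abs_nonneg γ.expanding, abs_nonneg γ.contracting]
  have hkb : k.contracting ≠ 0 := by
    rw [hk, contracting_commutator]
    have h := abs_le.1 (hsmall (-δ.t) γ.contracting (by rwa [abs_neg]))
    nlinarith [abs_nonneg γ.expanding, abs_nonneg γ.contracting]
  have hkL : k ∈ L := mul_mem (mul_mem (mul_mem hγ hδ) (inv_mem hγ)) (inv_mem hδ)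
  -- `ω(k, γkγ⁻¹)` is half of `e^{γ.t} - e^{-γ.t}` times the product of the two eigencoordinates of
  -- `k`.
  refine ⟨k, hkL, γ * k * γ⁻¹, mul_mem (mul_mem hγ hkL) (inv_mem hγ), hkt, by simp [hkt], hka, ?_⟩
  rw [omegaForm_eq, expanding_conj _ _ hkt, contracting_conj _ _ hkt]
  have h : k.contracting * (Real.exp γ.t * k.expanding) -
      k.expanding * (Real.exp (-γ.t) * k.contracting) =
      (Real.exp γ.t - Real.exp (-γ.t)) * (k.expanding * k.contracting) := by ring
  rw [h]
  have : Real.exp γ.t - Real.exp (-γ.t) ≠ 0 := by linarith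
  positivity

/-! ### Reduction to a compact set, and finiteness of small `t` -/

theorem commutator_eq {k₁ k₂ : Osc} (h₁ : k₁.t = 0) (h₂ : k₂.t = 0) :
    k₁ * k₂ * k₁⁻¹ * k₂⁻¹ = ⟨omegaForm k₁.ξ k₂.ξ, 0, 0⟩ := by
  ext <;> simp [h₁, h₂, hypRot, omegaForm]
  ring

theorem zpow_t (q : Osc) (n : ℤ) : (q ^ n).t = n * q.t := by
  induction n using Int.induction_on with
  | zero => simp
  | succ n ih => rw [zpow_add_one, mul_t, ih]; push_cast; ring
  | pred n ih => rw [zpow_sub_one, mul_t, ih, inv_t]; push_cast; ring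

theorem zpow_ξ {q : Osc} (hq : q.t = 0) (n : ℤ) : (q ^ n).ξ = (n : ℝ) • q.ξ := by
  have h0 : ∀ ξ, hypRot 0 ξ = ξ := fun ξ => by simp [hypRot]
  induction n using Int.induction_on with
  | zero => simp
  | succ n ih =>
    rw [zpow_add_one, mul_ξ, ih, zpow_t, hq, mul_zero, h0]
    push_cast
    module
  | pred n ih =>
    rw [zpow_sub_one, mul_ξ, ih, zpow_t, hq, mul_zero, h0, inv_ξ, hq, neg_zero, h0]
    push_cast
    module

theorem zpow_central (c : ℝ) (n : ℤ) : (⟨c, 0, 0⟩ : Osc) ^ n = ⟨n * c, 0, 0⟩ := by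
  induction n using Int.induction_on with
  | zero => ext <;> simp
  | succ n ih =>
    rw [zpow_add_one, ih]
    ext <;> simp [omegaForm, hypRot]
    ring
  | pred n ih =>
    rw [zpow_sub_one, ih]
    ext <;> simp [omegaForm, hypRot]
    ring

theorem exists_int_mul_add_mem_Icc {c : ℝ} (hc : c ≠ 0) (x : ℝ) :
    ∃ n : ℤ, n * c + x ∈ Set.Icc (-|c|) |c| := by
  refine ⟨-⌊x / c⌋, ?_⟩
  have h : ((-⌊x / c⌋ : ℤ) : ℝ) * c + x = Int.fract (x / c) * c := by
    have := Int.floor_add_fract (x / c)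
    push_cast
    rw [show Int.fract (x / c) = x / c - ⌊x / c⌋ by linarith]
    field_simp
    ring
  rw [h, Set.mem_Icc, ← abs_le, abs_mul, abs_of_nonneg (Int.fract_nonneg _)]
  exact mul_le_of_le_one_left (abs_nonneg c) (Int.fract_lt_one _).le

/-- A subgroup containing a nontrivial central element moves every element to one with bounded `z`,
without changing `ξ` and `t`. -/
theorem exists_mem_z_mem_Icc {L : Subgroup Osc} {c : ℝ} (hc : c ≠ 0) (hL : ⟨c, 0, 0⟩ ∈ L)
    (x : Osc) : ∃ l ∈ L, (l * x).z ∈ Set.Icc (-|c|) |c| ∧ (l * x).ξ = x.ξ ∧ (l * x).t = x.t := by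
  obtain ⟨n, hn⟩ := exists_int_mul_add_mem_Icc hc x.z
  refine ⟨_, L.zpow_mem hL n, ?_⟩
  rw [zpow_central]
  refine ⟨?_, ?_, ?_⟩
  · simpa [omegaForm] using hn
  · simp [hypRot]
  · simp

theorem isCompact_box (c : ℝ) {K : Set (ℝ × ℝ)} (hK : IsCompact K) (T : ℝ) :
    IsCompact {x : Osc | x.z ∈ Set.Icc (-c) c ∧ x.ξ ∈ K ∧ x.t ∈ Set.Icc (-T) T} := by
  have h : IsCompact (Set.Icc (-c) c ×ˢ K ×ˢ Set.Icc (-T) T) :=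
    isCompact_Icc.prod (hK.prod isCompact_Icc)
  convert! homeo.isClosedEmbedding.isCompact_preimage h using 1

/-- A subgroup of `Osc` that contains an element outside the Heisenberg subgroup and two
non-commuting elements in it is cocompact. -/
theorem exists_isCompact_cover {L : Subgroup Osc} {γ k₁ k₂ : Osc} (hγ : γ ∈ L) (hk₁ : k₁ ∈ L)
    (hk₂ : k₂ ∈ L) (ht : γ.t ≠ 0) (h₁ : k₁.t = 0) (h₂ : k₂.t = 0)
    (hω : omegaForm k₁.ξ k₂.ξ ≠ 0) :
    ∃ K : Set Osc, IsCompact K ∧ ∀ x, ∃ l ∈ L, l * x ∈ K := by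
  have hc : (⟨omegaForm k₁.ξ k₂.ξ, 0, 0⟩ : Osc) ∈ L := by
    rw [← commutator_eq h₁ h₂]
    exact mul_mem (mul_mem (mul_mem hk₁ hk₂) (inv_mem hk₁)) (inv_mem hk₂)
  set c := omegaForm k₁.ξ k₂.ξ with hcdef
  let P : Set (ℝ × ℝ) := (fun p : ℝ × ℝ => p.1 • k₁.ξ + p.2 • k₂.ξ) ''
    (Set.Icc (-|1|) |1| ×ˢ Set.Icc (-|1|) |1|)
  have hP : IsCompact P := (isCompact_Icc.prod isCompact_Icc).image (by fun_prop)
  refine ⟨_, isCompact_box |c| hP |γ.t|, fun x => ?_⟩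
  -- The order matters: `γ` disturbs `ξ` and `z`, the `kᵢ` fix `t` but disturb `z`, and central
  -- elements disturb neither `t` nor `ξ`.
  obtain ⟨n, hn⟩ := exists_int_mul_add_mem_Icc ht x.t
  set y := γ ^ n * x with hy
  have hyt : y.t = n * γ.t + x.t := by rw [hy, mul_t, zpow_t]
  -- By Cramer's rule these quotients are the coordinates of `y.ξ` in the basis `k₁.ξ`, `k₂.ξ`.
  obtain ⟨m₁, hm₁⟩ := exists_int_mul_add_mem_Icc one_ne_zero (omegaForm y.ξ k₂.ξ / c)
  obtain ⟨m₂, hm₂⟩ := exists_int_mul_add_mem_Icc one_ne_zero (omegaForm k₁.ξ y.ξ / c)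
  set w := k₁ ^ m₁ * (k₂ ^ m₂ * y) with hw
  have hwt : w.t = y.t := by simp [hw, zpow_t, h₁, h₂]
  have hwξ : w.ξ ∈ P := by
    refine ⟨(m₁ * 1 + omegaForm y.ξ k₂.ξ / c, m₂ * 1 + omegaForm k₁.ξ y.ξ / c), ⟨hm₁, hm₂⟩, ?_⟩
    have hadd : ∀ a b : Osc, a.t = 0 → (a * b).ξ = a.ξ + b.ξ := fun a b ha => by
      simp [ha, hypRot]
    rw [hw, hadd (k₁ ^ m₁) _ (by rw [zpow_t, h₁, mul_zero]),
      hadd (k₂ ^ m₂) y (by rw [zpow_t, h₂, mul_zero]), zpow_ξ h₁, zpow_ξ h₂]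
    have e1 : (omegaForm y.ξ k₂.ξ / c) * k₁.ξ.1 + (omegaForm k₁.ξ y.ξ / c) * k₂.ξ.1 = y.ξ.1 := by
      field_simp
      simp only [hcdef, omegaForm]
      ring
    have e2 : (omegaForm y.ξ k₂.ξ / c) * k₁.ξ.2 + (omegaForm k₁.ξ y.ξ / c) * k₂.ξ.2 = y.ξ.2 := by
      field_simp
      simp only [hcdef, omegaForm]
      ring
    ext
    · simp
      linear_combination e1
    · simp
      linear_combination e2
  obtain ⟨l, hl, hlz, hlξ, hlt⟩ := exists_mem_z_mem_Icc hω hc w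
  refine ⟨l * (k₁ ^ m₁ * (k₂ ^ m₂ * γ ^ n)), mul_mem hl (mul_mem (L.zpow_mem hk₁ _)
    (mul_mem (L.zpow_mem hk₂ _) (L.zpow_mem hγ _))), ?_⟩
  have e : l * (k₁ ^ m₁ * (k₂ ^ m₂ * γ ^ n)) * x = l * w := by
    simp only [hw, hy, mul_assoc]
  rw [e]
  refine ⟨hlz, ?_, ?_⟩
  · rw [hlξ]
    exact hwξ
  · rw [hlt, hwt, hyt]
    exact hn

/-- Small values of `t` on a discrete subgroup with two non-commuting elements in the Heisenberg
subgroup form a finite set: `t` is read off from the conjugation action on these elements. -/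
theorem finite_image_t {L : Subgroup Osc} [DiscreteTopology L] {k₁ k₂ : Osc} (hk₁ : k₁ ∈ L)
    (hk₂ : k₂ ∈ L) (h₁ : k₁.t = 0) (h₂ : k₂.t = 0) (ha : k₁.expanding ≠ 0)
    (hω : omegaForm k₁.ξ k₂.ξ ≠ 0) : (Osc.t '' {l : Osc | l ∈ L ∧ |l.t| ≤ 1}).Finite := by
  have hc : (⟨omegaForm k₁.ξ k₂.ξ, 0, 0⟩ : Osc) ∈ L := by
    rw [← commutator_eq h₁ h₂]
    exact mul_mem (mul_mem (mul_mem hk₁ hk₂) (inv_mem hk₁)) (inv_mem hk₂)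
  set c := omegaForm k₁.ξ k₂.ξ
  let P : Set (ℝ × ℝ) := (fun s : ℝ => hypRot s k₁.ξ) '' Set.Icc (-1) 1
  have hP : IsCompact P := isCompact_Icc.image
    (continuous_hypRot.comp (f := fun s : ℝ => (s, k₁.ξ)) (by fun_prop))
  -- The box is degenerate in `t` because conjugates of `k₁` have `t = 0`; `P` is the compact arc
  -- swept out by `e^{sA} k₁.ξ` for `|s| ≤ 1`.
  have hfin : (((↑) : L → Osc) ⁻¹'
      {x : Osc | x.z ∈ Set.Icc (-|c|) |c| ∧ x.ξ ∈ P ∧ x.t ∈ Set.Icc (-0) 0}).Finite :=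
    ((Subgroup.isClosed_of_discrete (H := L)).isClosedEmbedding_subtypeVal.isCompact_preimage
      (isCompact_box |c| hP 0)).finite_of_discrete
  refine (hfin.image fun l : L => Real.log ((l : Osc).expanding / k₁.expanding)).subset ?_
  rintro _ ⟨l, ⟨hl, ht⟩, rfl⟩
  have hconj : l * k₁ * l⁻¹ ∈ L := mul_mem (mul_mem hl hk₁) (inv_mem hl)
  obtain ⟨m, hm, hmz, hmξ, hmt⟩ := exists_mem_z_mem_Icc hω hc (l * k₁ * l⁻¹)
  refine ⟨⟨m * (l * k₁ * l⁻¹), mul_mem hm hconj⟩, ⟨hmz, ?_, ?_⟩, ?_⟩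
  · refine ⟨l.t, abs_le.1 ht, ?_⟩
    have ea := expanding_conj l k₁ h₁
    have eb := contracting_conj l k₁ h₁
    rw [← Real.cosh_add_sinh] at ea
    rw [← Real.cosh_sub_sinh] at eb
    simp only [expanding, contracting] at ea eb
    change _ = (m * (l * k₁ * l⁻¹)).ξ
    rw [hmξ]
    ext
    · simp only [hypRot]
      linarith
    · simp only [hypRot]
      linarith
  · change (m * (l * k₁ * l⁻¹)).t ∈ _
    rw [hmt]
    simp [h₁]
  · change Real.log ((m * (l * k₁ * l⁻¹)).expanding / k₁.expanding) = l.t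
    have e : (m * (l * k₁ * l⁻¹)).expanding = Real.exp l.t * k₁.expanding := by
      rw [← expanding_conj l k₁ h₁, expanding, hmξ, expanding]
    rw [e, mul_div_cancel_right₀ _ ha, Real.log_exp]

end Osc

/-- A set of reals whose differences meet `[-1, 1]` in a finite set is discrete. -/
theorem isDiscrete_of_finite_sub {S : Set ℝ}
    (h : {d : ℝ | |d| ≤ 1 ∧ ∃ x ∈ S, ∃ y ∈ S, d = x - y}.Finite) : IsDiscrete S := by
  rw [isDiscrete_iff_discreteTopology]
  set F := {d : ℝ | |d| ≤ 1 ∧ ∃ x ∈ S, ∃ y ∈ S, d = x - y} with hF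
  -- A finite set without `0` leaves a gap `ε` around `0`. The minimum with `1` is needed because
  -- `F` records only differences of size at most `1`.
  have hcl : IsClosed (F \ {0}) := (h.subset Set.sdiff_subset).isClosed
  obtain ⟨ε, hε, hball⟩ := Metric.isOpen_iff.1 hcl.isOpen_compl 0 (by simp)
  refine DiscreteTopology.of_forall_le_dist (r := min ε 1) (by positivity) fun x y hxy => ?_
  by_contra! hlt
  rw [Subtype.dist_eq, Real.dist_eq] at hlt
  have hmem : (x : ℝ) - y ∈ Metric.ball 0 ε := by
    rw [mem_ball_zero_iff, Real.norm_eq_abs]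
    exact hlt.trans_le (min_le_left _ _)
  refine hball hmem ⟨⟨(hlt.trans_le (min_le_right _ _)).le, x, x.2, y, y.2, rfl⟩, ?_⟩
  exact fun h0 => hxy (Subtype.ext (sub_eq_zero.1 h0))

/-! ### Quotients by lattices of `Osc` acting by left translations -/

namespace OscIsom

theorem continuous_iota : Continuous iota := by
  have h : Continuous fun q : Osc => swapA q.ξ := continuous_swapA.comp Osc.continuous_ξ
  exact continuous_mk (by fun_prop) (by fun_prop) (by fun_prop) (by fun_prop) (by fun_prop)

theorem isEmbedding_iota : Topology.IsEmbedding iota := by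
  have h : Continuous fun g : OscIsom => (⟨2 * g.z, (2 : ℝ) • g.ξ₁, 2 * g.t⟩ : Osc) :=
    Osc.continuous_mk (by fun_prop) (by fun_prop) (by fun_prop)
  refine Function.LeftInverse.isEmbedding (fun q => ?_) h continuous_iota
  ext <;> simp [iota] <;> ring

theorem isCompactQuotient_map_iota {L : Subgroup Osc} (hL : IsLatticeSubgroup L) :
    IsCompactQuotient (L.map iota) := by
  obtain ⟨γ, hγ, hγt⟩ := Osc.exists_mem_one_le_t hL
  obtain ⟨k₁, hk₁, k₂, hk₂, h₁, h₂, -, hω⟩ := Osc.exists_mem_omegaForm_ne_zero hL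
  obtain ⟨K, hK, hcov⟩ := Osc.exists_isCompact_cover hγ hk₁ hk₂ (by linarith) h₁ h₂ hω
  have := hL.1
  have := Subgroup.discreteTopology_map isEmbedding_iota L
  refine isCompactQuotient_of_equivariant continuous_iota ?_ hK fun x => ?_
  · rintro _ ⟨l, -, rfl⟩ x
    rw [iota_smul, map_mul]
  · obtain ⟨l, hl, hx⟩ := hcov x
    exact ⟨iota l, Subgroup.mem_map_of_mem _ hl, by rwa [iota_smul]⟩

theorem isStraight_map_iota {L : Subgroup Osc} (hL : IsLatticeSubgroup L) :
    IsStraight (L.map iota) := by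
  obtain ⟨k₁, hk₁, k₂, hk₂, h₁, h₂, ha, hω⟩ := Osc.exists_mem_omegaForm_ne_zero hL
  have := hL.1
  have hdisc : IsDiscrete (Osc.t '' (L : Set Osc)) := by
    refine isDiscrete_of_finite_sub ((Osc.finite_image_t hk₁ hk₂ h₁ h₂ ha hω).subset ?_)
    rintro _ ⟨hd, _, ⟨x, hx, rfl⟩, _, ⟨y, hy, rfl⟩, rfl⟩
    exact ⟨x * y⁻¹, ⟨mul_mem hx (inv_mem hy), by simpa [sub_eq_add_neg] using hd⟩,
      by simp [sub_eq_add_neg]⟩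
  -- `ι` halves `t`, and scaling by `1 / 2` is a homeomorphism of `ℝ`.
  have himg : proj '' (L.map iota : Set OscIsom) =
      Homeomorph.mulRight₀ (1 / 2 : ℝ) (by norm_num) '' (Osc.t '' (L : Set Osc)) := by
    rw [Subgroup.coe_map, Set.image_image, Set.image_image]
    refine Set.image_congr fun l _ => ?_
    simp [proj, iota]
    ring
  rw [IsStraight, himg]
  exact hdisc.image (Homeomorph.isInducing _)

end OscIsom

/-! ## Lattices from strict fundamental domains -/

open MeasureTheory in
/-- A discrete subgroup with a strict fundamental domain of finite positive measure, for a
bi-invariant measure, is a lattice. -/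
theorem isLatticeSubgroup_of_existsUnique {G : Type*} [Group G] [TopologicalSpace G]
    [IsTopologicalGroup G] [SecondCountableTopology G] [MeasurableSpace G] [BorelSpace G]
    (ν : Measure G) [ν.IsMulLeftInvariant] [ν.IsMulRightInvariant] {L : Subgroup G}
    [DiscreteTopology L] {F : Set G} (hF : MeasurableSet F)
    (hL : ∀ x : G, ∃! l : L, x * l ∈ F) (hfin : ν F ≠ ⊤) (hne : ν F ≠ 0) :
    IsLatticeSubgroup L := by
  refine ⟨inferInstance, ?_⟩
  let _ : MeasurableSpace (G ⧸ L) := borel (G ⧸ L)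
  have : BorelSpace (G ⧸ L) := ⟨rfl⟩
  have : Countable L := TopologicalSpace.separableSpace_iff_countable.1 inferInstance
  have : Countable L.op := L.equivOp.symm.injective.countable
  have hdom : IsFundamentalDomain L.op F ν := by
    refine IsFundamentalDomain.mk' hF.nullMeasurableSet fun x => ?_
    obtain ⟨l, hl, huniq⟩ := hL x
    refine ⟨L.equivOp l, hl, fun m hm => ?_⟩
    rw [← huniq (L.equivOp.symm m) hm, Equiv.apply_symm_apply]
  have hπ : Measurable (QuotientGroup.mk : G → G ⧸ L) := continuous_quotient_mk'.measurable
  have hF' : IsFiniteMeasure (ν.restrict F) := isFiniteMeasure_restrict.2 hfin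
  refine ⟨(ν.restrict F).map QuotientGroup.mk, inferInstance, ?_, ⟨fun g A hA => ?_⟩⟩
  · rw [Ne, Measure.map_eq_zero_iff hπ.aemeasurable, Measure.restrict_eq_zero]
    exact hne
  · have hA' : MeasurableSet ((QuotientGroup.mk : G → G ⧸ L) ⁻¹' A) := hπ hA
    have hg : Measurable fun x : G ⧸ L => g • x := (continuous_const_smul g).measurable
    rw [Measure.map_apply hπ hA, Measure.map_apply hπ (hg hA), Measure.restrict_apply hA',
      Measure.restrict_apply (hπ (hg hA))]
    have hinv : ∀ l : L.op, (fun x : G => l • x) ⁻¹' ((QuotientGroup.mk : G → G ⧸ L) ⁻¹' A) =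
        (QuotientGroup.mk : G → G ⧸ L) ⁻¹' A := by
      intro l
      ext x
      have : ((l • x : G) : G ⧸ L) = (x : G ⧸ L) :=
        (QuotientGroup.eq.2 (by
          rw [Subgroup.smul_def, MulOpposite.smul_eq_mul_unop, inv_mul_cancel_left]
          exact l.2)).symm
      simp only [Set.mem_preimage, this]
    -- Left translation commutes with the right action of `L`, so `g • F` is also a fundamental
    -- domain and gives `L`-invariant sets the same measure. Left invariance then moves `g • F` back
    -- to `F`.
    rw [← (hdom.smul_of_comm g).measure_set_eq hdom hA' hinv,
      ← measure_preimage_mul ν g ((QuotientGroup.mk : G → G ⧸ L) ⁻¹' A ∩ g • F)]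
    congr 1
    ext x
    simp only [Set.mem_inter_iff, Set.mem_preimage, ← smul_eq_mul, Set.smul_mem_smul_set_iff]
    rfl

/-! ## A lattice of `H × ℝ` with dense projection -/

/-- The group `H × ℝ`. -/
abbrev HeisenbergLine : Type := HeisenbergGroup × Multiplicative ℝ

namespace HeisenbergLine

/-- Coordinates `(ξ, t, z)` on `H × ℝ`. -/
def homeo : HeisenbergLine ≃ₜ ((ℝ × ℝ) × ℝ) × ℝ where
  toFun x := ((x.1.ξ, x.2.toAdd), x.1.z)
  invFun u := (⟨u.2, u.1.1⟩, Multiplicative.ofAdd u.1.2)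
  left_inv _ := rfl
  right_inv _ := rfl
  continuous_toFun := by
    have h : Continuous fun x : HeisenbergLine => x.2.toAdd :=
      continuous_toAdd.comp continuous_snd
    exact ((HeisenbergGroup.continuous_ξ.comp continuous_fst).prodMk h).prodMk
      (HeisenbergGroup.continuous_z.comp continuous_fst)
  continuous_invFun := by
    refine Continuous.prodMk (continuous_induced_rng.2 ?_) (continuous_ofAdd.comp (by fun_prop))
    exact Continuous.prodMk (by fun_prop) (by fun_prop)

instance : SecondCountableTopology HeisenbergLine := homeo.isEmbedding.secondCountableTopology

open MeasureTheory in
-- In the coordinates `(ξ, t, z)` left and right translations both have this form, with `d` affine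
-- in `ξ`; hence Lebesgue measure is bi-invariant.
theorem measurePreserving_shear (v : (ℝ × ℝ) × ℝ) {d : (ℝ × ℝ) × ℝ → ℝ} (hd : Continuous d) :
    MeasurePreserving (fun p : ((ℝ × ℝ) × ℝ) × ℝ => (p.1 + v, p.2 + d p.1)) := by
  have hv : MeasurePreserving fun a : (ℝ × ℝ) × ℝ => a + v :=
    ((measurePreserving_add_right volume v.1.1).prod
      (measurePreserving_add_right volume v.1.2)).prod (measurePreserving_add_right volume v.2)
  refine hv.skew_product
    (g := fun a z => z + d a) (Continuous.measurable ?_) (Filter.Eventually.of_forall fun a => ?_)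
  · unfold Function.uncurry
    fun_prop
  · exact map_add_right_eq_self volume (d a)

section Measure

open MeasureTheory

variable [MeasurableSpace HeisenbergLine] [BorelSpace HeisenbergLine]

/-- Lebesgue measure in the coordinates `(ξ, t, z)`. -/
noncomputable def lebesgue : Measure HeisenbergLine := volume.map homeo.symm

theorem map_lebesgue_eq {f : HeisenbergLine → HeisenbergLine} (hf : Continuous f)
    (h : MeasurePreserving fun p => homeo (f (homeo.symm p))) : lebesgue.map f = lebesgue := by
  have hs := homeo.symm.continuous.measurable
  rw [lebesgue, Measure.map_map hf.measurable hs]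
  conv_rhs => rw [← h.map_eq, Measure.map_map hs h.measurable]
  congr 1

instance : (lebesgue).IsMulLeftInvariant where
  map_mul_left_eq_self g := by
    refine map_lebesgue_eq (continuous_const_mul g) ?_
    convert! measurePreserving_shear (g.1.ξ, g.2.toAdd)
      (d := fun a => g.1.z + 1 / 2 * omegaForm g.1.ξ a.1) ?_ using 2 with p
    · refine Prod.ext (Prod.ext (add_comm _ _) (add_comm _ _)) ?_
      simp [homeo]
      ring
    · unfold omegaForm
      fun_prop

instance : (lebesgue).IsMulRightInvariant where
  map_mul_right_eq_self g := by
    refine map_lebesgue_eq (continuous_mul_const g) ?_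
    convert! measurePreserving_shear (g.1.ξ, g.2.toAdd)
      (d := fun a => g.1.z + 1 / 2 * omegaForm a.1 g.1.ξ) ?_ using 2 with p
    · refine Prod.ext rfl ?_
      simp [homeo]
      ring
    · unfold omegaForm
      fun_prop

end Measure

/-- The integral Heisenberg lattice, whose elements with first coordinate `m` are moved along the
line by `√2 m`, times the integers on the line. -/
def twistedLattice : Subgroup HeisenbergLine where
  carrier := {x | ∃ k m l n : ℤ, x.1.z = k / 2 ∧ x.1.ξ = ((m : ℝ), (l : ℝ)) ∧
    x.2.toAdd = n + √2 * m}
  one_mem' := ⟨0, 0, 0, 0, by simp, by simp [Prod.ext_iff], by simp⟩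
  mul_mem' := by
    rintro x y ⟨k, m, l, n, hz, hξ, ht⟩ ⟨k', m', l', n', hz', hξ', ht'⟩
    -- `ω` is integral on integer vectors, so the cocycle `½ω` stays in the half-integers allowed
    -- for `z`.
    refine ⟨k + k' + (m * l' - m' * l), m + m', l + l', n + n', ?_, ?_, ?_⟩
    · simp [hz, hz', hξ, hξ', omegaForm]
      ring
    · simp [hξ, hξ']
    · simp [ht, ht']
      ring
  inv_mem' := by
    rintro x ⟨k, m, l, n, hz, hξ, ht⟩
    refine ⟨-k, -m, -l, -n, ?_, ?_, ?_⟩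
    · simp [hz]
      ring
    · simp [hξ]
    · simp [ht]
      ring

/-- The half-open box in the coordinates `(ξ, t, z)`. -/
def box : Set HeisenbergLine :=
  homeo ⁻¹' (((Set.Ico 0 1 ×ˢ Set.Ico 0 1) ×ˢ Set.Ico 0 1) ×ˢ Set.Ico 0 (1 / 2))

theorem add_intCast_mem_Ico_iff (c : ℝ) (m : ℤ) : c + m ∈ Set.Ico (0 : ℝ) 1 ↔ m = -⌊c⌋ := by
  rw [eq_neg_iff_add_eq_zero, add_comm m, ← Int.floor_add_intCast, Int.floor_eq_iff]
  simp

/-- The conditions are triangular: `ξ` determines `m` and `j`, after which `n` and `k` are each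
determined by a single floor. -/
theorem existsUnique_mul_mem_box (x : HeisenbergLine) : ∃! l : twistedLattice, x * l ∈ box := by
  have key : ∀ (l : HeisenbergLine) (k m j n : ℤ), l.1.z = k / 2 → l.1.ξ = ((m : ℝ), (j : ℝ)) →
      l.2.toAdd = n + √2 * m → (x * l ∈ box ↔ m = -⌊x.1.ξ.1⌋ ∧ j = -⌊x.1.ξ.2⌋ ∧
        n = -⌊x.2.toAdd + √2 * m⌋ ∧ k = -⌊2 * x.1.z + (x.1.ξ.1 * j - m * x.1.ξ.2)⌋) := by
    intro l k m j n hz hξ ht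
    have hk : x.1.z + k / 2 + 1 / 2 * (x.1.ξ.1 * j - m * x.1.ξ.2) ∈ Set.Ico (0 : ℝ) (1 / 2) ↔
        2 * x.1.z + (x.1.ξ.1 * j - m * x.1.ξ.2) + k ∈ Set.Ico (0 : ℝ) 1 := by
      constructor <;> rintro ⟨h1, h2⟩ <;> constructor <;> linarith
    have hn : x.2.toAdd + (n + √2 * m) = x.2.toAdd + √2 * m + n := by ring
    simp only [← add_intCast_mem_Ico_iff]
    rw [← hk, ← hn, ← ht, ← hz]
    simp [box, homeo, hξ, omegaForm, and_assoc]
  set m := -⌊x.1.ξ.1⌋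
  set j := -⌊x.1.ξ.2⌋
  set n := -⌊x.2.toAdd + √2 * m⌋ with hn
  set k := -⌊2 * x.1.z + (x.1.ξ.1 * j - m * x.1.ξ.2)⌋ with hk
  refine ⟨⟨(⟨(k : ℝ) / 2, (m, j)⟩, Multiplicative.ofAdd (n + √2 * m)),
    k, m, j, n, rfl, rfl, rfl⟩, (key _ k m j n rfl rfl rfl).2 ⟨rfl, rfl, rfl, rfl⟩, ?_⟩
  rintro ⟨l, k', m', j', n', hz, hξ, ht⟩ hl
  obtain ⟨rfl, rfl, h3, h4⟩ := (key l k' m' j' n' hz hξ ht).1 hl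
  rw [← hn] at h3
  rw [← hk] at h4
  subst h3 h4
  exact Subtype.ext (Prod.ext (HeisenbergGroup.ext hz hξ) ht)

/-- Small `ξ` forces `m = 0`, which kills the term `√2 * m`; then small `t` forces `n = 0`. Thus
density of the `t` values does not spoil discreteness. -/
instance : DiscreteTopology twistedLattice := by
  refine discreteTopology_of_isOpen_singleton_one (isOpen_induced_iff.2
    ⟨homeo ⁻¹' (((Set.Ioo (-1) 1 ×ˢ Set.Ioo (-1) 1) ×ˢ Set.Ioo (-1) 1) ×ˢ
      Set.Ioo (-(1 / 2)) (1 / 2)), ?_, ?_⟩)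
  · exact (((isOpen_Ioo.prod isOpen_Ioo).prod isOpen_Ioo).prod isOpen_Ioo).preimage homeo.continuous
  · refine Set.eq_singleton_iff_unique_mem.2 ⟨by simp [homeo], ?_⟩
    rintro ⟨x, k, m, l, n, hz, hξ, ht⟩ ⟨⟨⟨h1, h2⟩, h3⟩, h4⟩
    have hzero : ∀ i : ℤ, (i : ℝ) ∈ Set.Ioo (-1 : ℝ) 1 → i = 0 := by
      rintro i ⟨hi, hi'⟩
      have a : (-1 : ℤ) < i := by exact_mod_cast hi
      have b : i < (1 : ℤ) := by exact_mod_cast hi'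
      omega
    simp only [homeo, Homeomorph.homeomorph_mk_coe, Equiv.coe_fn_mk, hz, hξ, ht] at h1 h2 h3 h4
    obtain rfl := hzero m h1
    obtain rfl := hzero l h2
    obtain rfl := hzero n (by simpa using h3)
    obtain rfl := hzero k ⟨by linarith [h4.1], by linarith [h4.2]⟩
    refine Subtype.ext (Prod.ext (HeisenbergGroup.ext ?_ ?_) ?_)
    · simpa using hz
    · simpa [Prod.ext_iff] using hξ
    · change x.2.toAdd = 0
      simpa using ht

theorem isLatticeSubgroup_twistedLattice : IsLatticeSubgroup twistedLattice := by
  let _ : MeasurableSpace HeisenbergLine := borel HeisenbergLine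
  have : BorelSpace HeisenbergLine := ⟨rfl⟩
  have hbox : MeasurableSet box := homeo.continuous.measurable
    (((measurableSet_Ico.prod measurableSet_Ico).prod measurableSet_Ico).prod measurableSet_Ico)
  have hvol : lebesgue box = ENNReal.ofReal (1 / 2) := by
    rw [lebesgue, MeasureTheory.Measure.map_apply homeo.symm.continuous.measurable hbox, box,
      ← Set.preimage_comp]
    simp [MeasureTheory.Measure.volume_eq_prod]
  refine isLatticeSubgroup_of_existsUnique lebesgue hbox existsUnique_mul_mem_box ?_ ?_
  · simp [hvol]
  · simp [hvol]

theorem dense_image_twistedLattice :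
    Dense ((fun x : HeisenbergLine => x.2.toAdd) '' (twistedLattice : Set HeisenbergLine)) := by
  have h : Dense (AddSubgroup.closure {√2, 1} : Set ℝ) :=
    dense_addSubgroupClosure_pair_iff.2 (by simpa using irrational_sqrt_two)
  refine h.mono ?_
  intro t ht
  obtain ⟨m, n, rfl⟩ := AddSubgroup.mem_closure_pair.1 ht
  refine ⟨(⟨0, (m, 0)⟩, Multiplicative.ofAdd (n + √2 * m)),
    ⟨0, m, 0, n, by simp, by simp, rfl⟩, ?_⟩
  simp
  ring

end HeisenbergLine

/-! ### The simply transitive action of `N` and the non-straight quotient -/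

theorem hypRot_hypRot_neg (t : ℝ) (ξ : ℝ × ℝ) : hypRot t (hypRot (-t) ξ) = ξ := by
  have h := Real.cosh_sq t
  ext
  · simp [hypRot]
    linear_combination ξ.1 * h
  · simp [hypRot]
    linear_combination ξ.2 * h

theorem planeConj_planeConj (ξ : ℝ × ℝ) : planeConj (planeConj ξ) = ξ := by
  simp [planeConj]

namespace OscIsom

/-- The embedding of `H × ℝ` into the isometry group with image `N`. -/
noncomputable def embN : HeisenbergLine →* OscIsom :=
  subgroupN.subtype.comp equivN.toMulEquiv.toMonoidHom

theorem isEmbedding_embN : Topology.IsEmbedding embN :=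
  Topology.IsEmbedding.subtypeVal.comp equivN.toHomeomorph.isEmbedding

/-- `N` acts simply transitively on `Osc`: the inverse of the orbit map at `1`. -/
noncomputable def orbitInv : Osc ≃ₜ HeisenbergLine where
  toFun x := (⟨x.z / 4, (1 / 2 : ℝ) • planeConj (hypRot (-x.t) x.ξ)⟩, Multiplicative.ofAdd (x.t / 2))
  invFun g := ⟨4 * g.1.z, hypRot (2 * g.2.toAdd) (planeConj ((2 : ℝ) • g.1.ξ)), 2 * g.2.toAdd⟩
  left_inv x := by
    have h2 : 2 * (x.t / 2) = x.t := by ring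
    have h4 : 4 * (x.z / 4) = x.z := by ring
    simp [h2, h4, smul_smul, planeConj_planeConj, hypRot_hypRot_neg]
  right_inv g := by
    have h := hypRot_hypRot_neg (-(2 * g.2.toAdd)) (planeConj ((2 : ℝ) • g.1.ξ))
    rw [neg_neg] at h
    refine Prod.ext (HeisenbergGroup.ext ?_ ?_) ?_
    · simp
    · simp [h, planeConj_planeConj, smul_smul]
    · simp
  continuous_toFun := by
    have h : Continuous fun x : Osc => planeConj (hypRot (-x.t) x.ξ) :=
      continuous_planeConj.comp (continuous_hypRot.comp (f := fun x : Osc => (-x.t, x.ξ))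
        (by fun_prop))
    exact Continuous.prodMk (continuous_induced_rng.2 (Continuous.prodMk (by fun_prop) (by fun_prop)))
      (continuous_ofAdd.comp (by fun_prop))
  continuous_invFun := by
    have ht : Continuous fun g : HeisenbergLine => 2 * g.2.toAdd :=
      continuous_const.mul (continuous_toAdd.comp continuous_snd)
    have hξ : Continuous fun g : HeisenbergLine => planeConj ((2 : ℝ) • g.1.ξ) :=
      continuous_planeConj.comp (by fun_prop)
    exact Osc.continuous_mk (by fun_prop) (continuous_hypRot.comp (ht.prodMk hξ)) ht

/-- On `N` the vector `ξ₁ + Aξ₂` vanishes, so `ξ` acts by right translation by `2 conj(ξ)`.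
Conjugation reverses the sign of `ω`, which turns this into left multiplication in `H`. -/
theorem orbitInv_embN_smul (g : HeisenbergLine) (x : Osc) :
    orbitInv (embN g • x) = g * orbitInv x := by
  obtain ⟨⟨z, ξ⟩, t⟩ := g
  have e : embN (⟨z, ξ⟩, t) = ⟨2 * z, ξ, -swapA ξ, t.toAdd, t.toAdd⟩ := rfl
  rw [e, smul_def]
  refine Prod.ext (HeisenbergGroup.ext ?_ (Prod.ext ?_ ?_)) ?_
  case refine_4 =>
    change (_ : ℝ) / 2 = t.toAdd + x.t / 2
    simp
    ring
  all_goals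
    simp only [orbitInv, Homeomorph.homeomorph_mk_coe, Equiv.coe_fn_mk, Osc.mul_z, Osc.mul_ξ,
      Osc.mul_t, Prod.fst_mul, HeisenbergGroup.mul_z, HeisenbergGroup.mul_ξ, omegaForm, hypRot,
      swapA, planeConj, Prod.fst_add, Prod.snd_add, Prod.fst_sub, Prod.snd_sub, Prod.fst_neg,
      Prod.snd_neg, Prod.smul_fst, Prod.smul_snd, smul_eq_mul, Prod.fst_zero, Prod.snd_zero,
      Real.cosh_eq, Real.sinh_eq, sub_self, neg_add, neg_neg, neg_zero, Real.exp_zero,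
      Real.exp_add, Real.exp_neg, mul_zero, zero_mul, add_zero, zero_add]
    field_simp
    ring

theorem isCompactQuotient_map_embN :
    IsCompactQuotient (HeisenbergLine.twistedLattice.map embN) := by
  have := Subgroup.discreteTopology_map isEmbedding_embN HeisenbergLine.twistedLattice
  have hC : IsCompact (HeisenbergLine.homeo ⁻¹'
      (((Set.Icc 0 1 ×ˢ Set.Icc 0 1) ×ˢ Set.Icc 0 1) ×ˢ Set.Icc 0 (1 / 2))) :=
    HeisenbergLine.homeo.isCompact_preimage.2
      (((isCompact_Icc.prod isCompact_Icc).prod isCompact_Icc).prod isCompact_Icc)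
  -- The box is a fundamental domain for right multiplication while the action is on the left, hence
  -- the inverses of `C` and of the lattice element.
  refine isCompactQuotient_of_equivariant (isEmbedding_embN.continuous.comp orbitInv.continuous) ?_
    (orbitInv.isCompact_preimage.2 hC.inv) fun x => ?_
  · rintro _ ⟨l, -, rfl⟩ x
    simp only [Function.comp_apply, orbitInv_embN_smul, map_mul]
  · obtain ⟨l, hl, -⟩ := HeisenbergLine.existsUnique_mul_mem_box (orbitInv x)⁻¹
    refine ⟨embN (l : HeisenbergLine)⁻¹, Subgroup.mem_map_of_mem _ (inv_mem l.2), ?_⟩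
    rw [Set.mem_preimage, orbitInv_embN_smul, Set.mem_inv, mul_inv_rev, inv_inv]
    exact Set.preimage_mono (Set.prod_mono (Set.prod_mono (Set.prod_mono Set.Ico_subset_Icc_self
      Set.Ico_subset_Icc_self) Set.Ico_subset_Icc_self) Set.Ico_subset_Icc_self) hl

theorem not_isStraight_map_embN : ¬ IsStraight (HeisenbergLine.twistedLattice.map embN) := by
  intro h
  have himg : proj '' (HeisenbergLine.twistedLattice.map embN : Set OscIsom) =
      (fun x : HeisenbergLine => x.2.toAdd) '' (HeisenbergLine.twistedLattice : Set _) := by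
    rw [Subgroup.coe_map, Set.image_image]
    rfl
  rw [IsStraight, himg, isDiscrete_iff_forall_mem_exists_isOpen] at h
  obtain ⟨U, hU, hU0⟩ := h 0 ⟨1, one_mem _, rfl⟩
  have h0 : (0 : ℝ) ∈ U := (hU0.symm ▸ Set.mem_singleton (0 : ℝ) :
    (0 : ℝ) ∈ U ∩ _).1
  -- Discreteness would isolate `0` in the projection, but a dense set meets the nonempty open set
  -- `U \ {0}`.
  have hne : (U \ {0}).Nonempty := by
    obtain ⟨ε, hε, hball⟩ := Metric.isOpen_iff.1 hU 0 h0
    refine ⟨ε / 2, hball ?_, by simpa using hε.ne'⟩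
    rw [mem_ball_zero_iff, Real.norm_eq_abs, abs_of_pos (by positivity)]
    linarith
  obtain ⟨y, ⟨hyU, hy0⟩, hyS⟩ := HeisenbergLine.dense_image_twistedLattice.inter_open_nonempty _
    (hU.sdiff isClosed_singleton) hne
  exact hy0 (hU0 ▸ (⟨hyU, hyS⟩ : y ∈ U ∩ _))

end OscIsom

theorem proposition10p3 :
    (∀ L : Subgroup Osc, IsLatticeSubgroup L →
      OscIsom.IsCompactQuotient (L.map OscIsom.iota) ∧ OscIsom.IsStraight (L.map OscIsom.iota)) ∧
    (∃ Λ : Subgroup (HeisenbergGroup × Multiplicative ℝ), IsLatticeSubgroup Λ ∧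
      Dense ((fun x : HeisenbergGroup × Multiplicative ℝ => x.2.toAdd) '' (Λ : Set _)) ∧
      OscIsom.IsCompactQuotient
        ((Λ.map OscIsom.equivN.toMulEquiv.toMonoidHom).map OscIsom.subgroupN.subtype) ∧
      ¬ OscIsom.IsStraight
        ((Λ.map OscIsom.equivN.toMulEquiv.toMonoidHom).map OscIsom.subgroupN.subtype)) := by
  refine ⟨fun L hL => ⟨OscIsom.isCompactQuotient_map_iota hL, OscIsom.isStraight_map_iota hL⟩,
    HeisenbergLine.twistedLattice, HeisenbergLine.isLatticeSubgroup_twistedLattice,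
    HeisenbergLine.dense_image_twistedLattice, ?_, ?_⟩
  · rw [Subgroup.map_map]
    exact OscIsom.isCompactQuotient_map_embN
  · rw [Subgroup.map_map]
    exact OscIsom.not_isStraight_map_embN
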